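/- Let $\Gamma$ be a locally compact Hausdorff topological groupoid with unit space $X$ and source and range maps $s,r:\Gamma\to X$, and let $A$ be a $C_0(X)$-algebra, i.e. a $C^*$-algebra with a $*$-homomorphism $\theta:C_0(X)\to ZM(A)$ into the centre of its multiplier algebra such that $\theta(C_0(X))A=A$; write $fa=\theta(f)a$. For $x\in X$ let $I_x=\{f\in C_0(X): f(x)=0\}$, let $A_x=A/I_xA$, and let $a_x\in A_x$ be the image of $a\in A$. Let $A^\sharp=\bigsqcup_{x\in X}A_x$ with projection $p:A^\sharp\to X$, and with the topology generated by the sets $U(a,\varepsilon)=\{z\in A_x: x\in U,\ \|z-a_x\|<\varepsilon\}$, where $U\subseteq X$ is open, $a\in A$, $\varepsilon>0$. For a continuous map $q:Y\to X$ from a locally compact Hausdorff space $Y$ let $q^*A=(A\otimes_{\max}C_0(Y))/I$, where $I$ is the closed ideal generated by the differences $fa\otimes F-a\otimes (f\circ q)F$ with $a\in A$, $f\in C_0(X)$, $F\in C_0(Y)$. It is a $C_0(Y)$-algebra by $F'(a\otimes F)=a\otimes F'F$, and $(q^*A)_y$ is identified with $A_{q(y)}$ by $(a\otimes F)_y\mapsto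 F(y)a_{q(y)}$. A $\Gamma$-algebra structure on $A$ is a $C_0(\Gamma)$-linear $*$-isomorphism $\alpha:s^*A\to r^*A$ such that the induced isomorphisms of the fibres, $\alpha_\gamma:A_{s(\gamma)}=(s^*A)_\gamma\to (r^*A)_\gamma=A_{r(\gamma)}$, satisfy $\alpha_{\gamma\gamma'}=\alpha_\gamma\alpha_{\gamma'}$ whenever $r(\gamma')=s(\gamma)$, and $\alpha_{\gamma^{-1}}=\alpha_\gamma^{-1}$ for all $\gamma\in\Gamma$. The bundle $A^\sharp$ is a continuous $\Gamma$-space of $C^*$-algebras if $p:A^\sharp\to X$ is continuous, open and onto, and there are given $*$-isomorphisms $\alpha_\gamma:A_{s(\gamma)}\to A_{r(\gamma)}$ ($\gamma\in\Gamma$) such that $\alpha_x=\mathrm{id}$ for each unit $x$, $\alpha_{\gamma\gamma'}=\alpha_\gamma\alpha_{\gamma'}$ whenever $r(\gamma')=s(\gamma)$, and the map $(\gamma,z)\mapsto\alpha_\gamma(z)$ from $\Gamma\times_sA^\sharp=\{(\gamma,z)\in\Gamma\times A^\sharp: s(\gamma)=p(z)\}$ to $A^\sharp$ is continuous. **Theorem.**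 $A$ is a $\Gamma$-algebra if and only if $A^\sharp$ is a continuous $\Gamma$-space of $C^*$-algebras: $A$ has a $\Gamma$-algebra structure if and only if $A^\sharp$ has a structure of continuous $\Gamma$-space of $C^*$-algebras. More precisely, sending $\alpha$ to the family $(\alpha_\gamma)_{\gamma\in\Gamma}$ of its induced isomorphisms is a bijection from the $\Gamma$-algebra structures on $A$ onto the structures of continuous $\Gamma$-space of $C^*$-algebras on $A^\sharp$. -/

import Mathlib

open scoped ZeroAtInfty TensorProduct MultiplierAlgebra Topology

universe u v

noncomputable section

/-! ### Closed ideals and quotients of C⋆-algebras -/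

theorem continuous_starHom {A B : Type*} [NonUnitalCStarAlgebra A] [NonUnitalCStarAlgebra B]
    (φ : A →⋆ₙₐ[ℂ] B) : Continuous φ :=
  AddMonoidHomClass.continuous_of_bound φ 1 fun a => by
    simpa using NonUnitalStarAlgHom.norm_apply_le φ a

/-- A closed two-sided ideal of a C⋆-algebra (such an ideal is automatically self-adjoint; this is
recorded as a field). -/
structure ClosedIdeal (A : Type*) [NonUnitalCStarAlgebra A] extends Submodule ℂ A where
  mul_left_mem : ∀ a {b : A}, b ∈ carrier → a * b ∈ carrier
  mul_right_mem : ∀ {a : A} b, a ∈ carrier → a * b ∈ carrier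
  star_mem : ∀ {a : A}, a ∈ carrier → star a ∈ carrier
  isClosed : IsClosed carrier

namespace ClosedIdeal

variable {A : Type*} [NonUnitalCStarAlgebra A]

/-- The smallest closed (self-adjoint, two-sided) ideal containing `S`. -/
def span (S : Set A) : ClosedIdeal A where
  carrier := {a | ∀ J : ClosedIdeal A, S ⊆ J.carrier → a ∈ J.carrier}
  add_mem' ha hb J hJ := J.add_mem' (ha J hJ) (hb J hJ)
  zero_mem' J _ := J.zero_mem'
  smul_mem' c _ ha J hJ := J.smul_mem' c (ha J hJ)
  mul_left_mem a _ hb J hJ := J.mul_left_mem a (hb J hJ)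
  mul_right_mem b ha J hJ := J.mul_right_mem b (ha J hJ)
  star_mem ha J hJ := J.star_mem (ha J hJ)
  isClosed := by
    simp only [Set.ofPred_forall]
    exact isClosed_iInter fun J => isClosed_iInter fun _ => J.isClosed

theorem subset_span (S : Set A) : S ⊆ (span S).carrier := fun _ ha _ hJ => hJ ha

theorem span_le {S : Set A} {J : ClosedIdeal A} (h : S ⊆ J.carrier) {a : A}
    (ha : a ∈ (span S).carrier) : a ∈ J.carrier := ha J h

/-- The kernel of a `*`-homomorphism of C⋆-algebras. -/
def ker {B : Type*} [NonUnitalCStarAlgebra B] (φ : A →⋆ₙₐ[ℂ] B) : ClosedIdeal A where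
  carrier := {a | φ a = 0}
  add_mem' {a b} ha hb := by simp_all
  zero_mem' := by simp
  smul_mem' c a ha := by simp_all
  mul_left_mem a b hb := by simp_all
  mul_right_mem b ha := by simp_all
  star_mem ha := by simp_all [map_star]
  isClosed := isClosed_singleton.preimage (continuous_starHom φ)

variable (J : ClosedIdeal A)

/-- The ideal, as a closed `*`-subalgebra. -/
def toStarSubalgebra : NonUnitalStarSubalgebra ℂ A where
  carrier := J.carrier
  add_mem' := J.add_mem'
  zero_mem' := J.zero_mem'
  smul_mem' := J.smul_mem'
  mul_mem' {a _} _ hb := J.mul_left_mem a hb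
  star_mem' := J.star_mem

instance : IsClosed (J.toSubmodule : Set A) := J.isClosed

section approx

attribute [local instance] CStarAlgebra.spectralOrder CStarAlgebra.spectralOrderedRing

theorem norm_compress_le (x e : A) (he : 0 ≤ e) (he1 : ‖e‖ ≤ 1) :
    ‖x - e * x - (x - e * x) * e‖ ≤ ‖x‖ := by
  set e' : Unitization ℂ A := (e : Unitization ℂ A)
  have h0 : 0 ≤ e' := Unitization.inr_nonneg_iff.mpr he
  have h1 : e' ≤ 1 := by
    rw [← CStarAlgebra.norm_le_one_iff_of_nonneg e' h0, Unitization.norm_inr]; exact he1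
  have h2 : ‖1 - e'‖ ≤ 1 := by
    rw [CStarAlgebra.norm_le_one_iff_of_nonneg (1 - e') (sub_nonneg.mpr h1)]
    simpa using h0
  have : ((x - e * x - (x - e * x) * e : A) : Unitization ℂ A) =
      (1 - e') * (x : Unitization ℂ A) * (1 - e') := by
    simp only [Unitization.inr_sub, Unitization.inr_mul, e']
    noncomm_ring
  rw [← Unitization.norm_inr (𝕜 := ℂ), this, ← Unitization.norm_inr (𝕜 := ℂ) (a := x)]
  calc _ ≤ ‖1 - e'‖ * ‖(x : Unitization ℂ A)‖ * ‖1 - e'‖ :=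
        (norm_mul_le _ _).trans (by gcongr; exact norm_mul_le _ _)
    _ ≤ 1 * ‖(x : Unitization ℂ A)‖ * 1 := by gcongr
    _ = _ := by ring

theorem exists_approx_unit {B : Type*} [NonUnitalCStarAlgebra B] (j : B) {ε : ℝ} (hε : 0 < ε) :
    ∃ b : B, ‖star b * b‖ ≤ 1 ∧ ‖j * (star b * b) - j‖ < ε := by
  have hau := CStarAlgebra.increasingApproximateUnit B
  have hne : (CStarAlgebra.approximateUnit B).NeBot := inferInstance
  have hd := (tendsto_iff_norm_sub_tendsto_zero.mp (hau.tendsto_mul_left j)).eventually_lt_const hε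
  obtain ⟨e, he0, he1, hed⟩ :=
    (hau.eventually_nonneg.and (hau.eventually_norm.and hd)).exists
  rw [CStarAlgebra.nonneg_iff_eq_star_mul_self] at he0
  obtain ⟨b, rfl⟩ := he0
  exact ⟨b, he1, hed⟩

theorem norm_mk_sq_le (a : A) {j : A} (hj : j ∈ J.carrier) :
    ‖(Submodule.Quotient.mk a : A ⧸ J.toSubmodule)‖ ^ 2 ≤ ‖star a * a + j‖ := by
  have : IsClosed (J.toStarSubalgebra : Set A) := J.isClosed
  refine le_of_forall_pos_le_add fun ε hε => ?_
  obtain ⟨b, he1, hed⟩ := exists_approx_unit (⟨j, hj⟩ : J.toStarSubalgebra)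
    (show 0 < ε / 2 by positivity)
  set e : J.toStarSubalgebra := star b * b with he
  have he0' : (0 : A) ≤ (e : A) := by
    rw [CStarAlgebra.nonneg_iff_eq_star_mul_self]
    exact ⟨b, rfl⟩
  have he1' : ‖(e : A)‖ ≤ 1 := he1
  have hsa : star (e : A) = e := (IsSelfAdjoint.of_nonneg he0').star_eq
  have hmem : a * (e : A) ∈ J.carrier := J.mul_left_mem a e.2
  have hq : ‖(Submodule.Quotient.mk a : A ⧸ J.toSubmodule)‖ ≤ ‖a - a * e‖ := by
    have : (Submodule.Quotient.mk a : A ⧸ J.toSubmodule) = Submodule.Quotient.mk (a - a * e) := by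
      rw [Submodule.Quotient.eq]; simpa using hmem
    rw [this]
    exact Submodule.Quotient.norm_mk_le _ _
  set x := star a * a with hx
  have h1 : star (a - a * (e : A)) * (a - a * e) = x - e * x - (x - e * x) * e := by
    rw [star_sub, star_mul, hsa, hx]; noncomm_ring
  have h2 : x - e * x - (x - e * x) * (e : A) =
      ((x + j) - e * (x + j) - ((x + j) - e * (x + j)) * e) - (j - j * e) + e * (j - j * e) := by
    noncomm_ring
  have h3 : ‖j - j * (e : A)‖ ≤ ε / 2 := by
    rw [norm_sub_rev]; exact hed.le
  calc _ ≤ ‖a - a * (e : A)‖ ^ 2 := by gcongr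
    _ = ‖x - e * x - (x - e * x) * (e : A)‖ := by
      rw [← h1, CStarRing.norm_star_mul_self, sq]
    _ ≤ ‖x + j‖ + ε / 2 + 1 * (ε / 2) := by
      rw [h2]
      refine (norm_add_le _ _).trans (add_le_add ((norm_sub_le _ _).trans (add_le_add ?_ h3)) ?_)
      · exact norm_compress_le _ _ he0' he1'
      · exact (norm_mul_le _ _).trans (by gcongr)
    _ = _ := by ring

end approx

/-- The quotient `A / J` with the quotient norm. Below it is made a C⋆-algebra. -/
def PreQuot : Type _ := A ⧸ J.toSubmodule

namespace PreQuot

instance : NormedAddCommGroup J.PreQuot := inferInstanceAs (NormedAddCommGroup (A ⧸ J.toSubmodule))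
instance : NormedSpace ℂ J.PreQuot := inferInstanceAs (NormedSpace ℂ (A ⧸ J.toSubmodule))
instance : CompleteSpace J.PreQuot := inferInstanceAs (CompleteSpace (A ⧸ J.toSubmodule))

/-- The quotient map, as a linear map. -/
def mkₗ : A →ₗ[ℂ] J.PreQuot := J.toSubmodule.mkQ

theorem mkₗ_surjective : Function.Surjective (mkₗ J) := J.toSubmodule.mkQ_surjective

theorem mkₗ_eq_mkₗ {a b : A} : mkₗ J a = mkₗ J b ↔ a - b ∈ J.carrier :=
  Submodule.Quotient.eq J.toSubmodule

instance : Mul J.PreQuot where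
  mul := Quotient.map₂ (· * ·) fun a a' ha b b' hb => by
    replace ha : a - a' ∈ J.toSubmodule := (Submodule.quotientRel_def _).1 ha
    replace hb : b - b' ∈ J.toSubmodule := (Submodule.quotientRel_def _).1 hb
    refine (Submodule.quotientRel_def _).2 ?_
    have : a * b - a' * b' = (a - a') * b + a' * (b - b') := by noncomm_ring
    rw [this]
    exact J.add_mem' (J.mul_right_mem _ ha) (J.mul_left_mem _ hb)

instance : Star J.PreQuot where
  star := Quotient.map star fun a a' ha => by
    replace ha : a - a' ∈ J.toSubmodule := (Submodule.quotientRel_def _).1 ha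
    refine (Submodule.quotientRel_def _).2 ?_
    rw [← star_sub]
    exact J.star_mem ha

theorem mkₗ_mul (a b : A) : mkₗ J (a * b) = mkₗ J a * mkₗ J b := rfl
theorem mkₗ_star (a : A) : mkₗ J (star a) = star (mkₗ J a) := rfl

theorem norm_mkₗ_le (a : A) : ‖mkₗ J a‖ ≤ ‖a‖ := Submodule.Quotient.norm_mk_le _ _

theorem exists_rep (x : J.PreQuot) {ε : ℝ} (hε : 0 < ε) : ∃ a, mkₗ J a = x ∧ ‖a‖ < ‖x‖ + ε :=
  Submodule.Quotient.norm_mk_lt x hε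

instance : NonUnitalRing J.PreQuot where
  __ := (inferInstance : AddCommGroup J.PreQuot)
  mul := (· * ·)
  left_distrib x y z := by
    obtain ⟨a, rfl⟩ := mkₗ_surjective J x
    obtain ⟨b, rfl⟩ := mkₗ_surjective J y
    obtain ⟨c, rfl⟩ := mkₗ_surjective J z
    simp only [← map_add, ← mkₗ_mul, mul_add]
  right_distrib x y z := by
    obtain ⟨a, rfl⟩ := mkₗ_surjective J x
    obtain ⟨b, rfl⟩ := mkₗ_surjective J y
    obtain ⟨c, rfl⟩ := mkₗ_surjective J z
    simp only [← map_add, ← mkₗ_mul, add_mul]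
  zero_mul x := by
    obtain ⟨a, rfl⟩ := mkₗ_surjective J x
    rw [← map_zero (mkₗ J), ← mkₗ_mul, zero_mul]
  mul_zero x := by
    obtain ⟨a, rfl⟩ := mkₗ_surjective J x
    rw [← map_zero (mkₗ J), ← mkₗ_mul, mul_zero]
  mul_assoc x y z := by
    obtain ⟨a, rfl⟩ := mkₗ_surjective J x
    obtain ⟨b, rfl⟩ := mkₗ_surjective J y
    obtain ⟨c, rfl⟩ := mkₗ_surjective J z
    simp only [← mkₗ_mul, mul_assoc]

instance : NonUnitalNormedRing J.PreQuot where
  __ := (inferInstance : NormedAddCommGroup J.PreQuot)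
  __ := (inferInstance : NonUnitalRing J.PreQuot)
  norm_mul_le x y := by
    refine le_of_forall_gt fun ε hε => ?_
    have hc : Filter.Tendsto (fun δ : ℝ => (‖x‖ + δ) * (‖y‖ + δ)) (𝓝[>] 0) (𝓝 (‖x‖ * ‖y‖)) := by
      have : Continuous (fun δ : ℝ => (‖x‖ + δ) * (‖y‖ + δ)) := by fun_prop
      simpa using (this.tendsto 0).mono_left nhdsWithin_le_nhds
    obtain ⟨δ, hδ, hδ0⟩ := ((hc.eventually_lt_const hε).and self_mem_nhdsWithin).exists
    obtain ⟨a, rfl, ha⟩ := exists_rep J x hδ0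
    obtain ⟨b, rfl, hb⟩ := exists_rep J y hδ0
    calc _ ≤ ‖a * b‖ := norm_mkₗ_le J (a * b)
      _ ≤ ‖a‖ * ‖b‖ := norm_mul_le _ _
      _ ≤ (‖mkₗ J a‖ + δ) * (‖mkₗ J b‖ + δ) := by gcongr
      _ < ε := hδ

instance : StarRing J.PreQuot where
  star_involutive x := by
    obtain ⟨a, rfl⟩ := mkₗ_surjective J x
    simp only [← mkₗ_star, star_star]
  star_mul x y := by
    obtain ⟨a, rfl⟩ := mkₗ_surjective J x
    obtain ⟨b, rfl⟩ := mkₗ_surjective J y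
    simp only [← mkₗ_star, ← mkₗ_mul, star_mul]
  star_add x y := by
    obtain ⟨a, rfl⟩ := mkₗ_surjective J x
    obtain ⟨b, rfl⟩ := mkₗ_surjective J y
    simp only [← mkₗ_star, ← map_add, star_add]

instance : CStarRing J.PreQuot where
  norm_mul_self_le x := by
    obtain ⟨a, rfl⟩ := mkₗ_surjective J x
    refine le_of_forall_pos_le_add fun ε hε => ?_
    obtain ⟨b, hb, hbn⟩ := exists_rep J (star (mkₗ J a) * mkₗ J a) hε
    rw [← mkₗ_star, ← mkₗ_mul, mkₗ_eq_mkₗ] at hb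
    have := J.norm_mk_sq_le a hb
    rw [add_sub_cancel] at this
    rw [← sq]
    exact this.trans hbn.le

instance : NonUnitalCStarAlgebra J.PreQuot where
  smul_assoc c x y := by
    obtain ⟨a, rfl⟩ := mkₗ_surjective J x
    obtain ⟨b, rfl⟩ := mkₗ_surjective J y
    simp only [smul_eq_mul, ← map_smul, ← mkₗ_mul, smul_mul_assoc]
  smul_comm c x y := by
    obtain ⟨a, rfl⟩ := mkₗ_surjective J x
    obtain ⟨b, rfl⟩ := mkₗ_surjective J y
    simp only [smul_eq_mul, ← map_smul, ← mkₗ_mul, mul_smul_comm]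
  star_smul c x := by
    obtain ⟨a, rfl⟩ := mkₗ_surjective J x
    simp only [← mkₗ_star, ← map_smul, star_smul]

/-- The quotient map, as a `*`-homomorphism. -/
def mk : A →⋆ₙₐ[ℂ] J.PreQuot where
  __ := mkₗ J
  map_zero' := map_zero (mkₗ J)
  map_mul' := mkₗ_mul J
  map_star' := mkₗ_star J

end PreQuot

/-- The quotient C⋆-algebra bundled with its quotient map. -/
structure QuotPackage {A : Type u} [NonUnitalCStarAlgebra A] (J : ClosedIdeal A) :
    Type (u + 1) where
  Carrier : Type u
  str : NonUnitalCStarAlgebra Carrier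
  proj : A →⋆ₙₐ[ℂ] Carrier
  mk_surjective : Function.Surjective proj
  mk_eq_zero : ∀ {a : A}, proj a = 0 ↔ a ∈ J.carrier
  exists_rep : ∀ (x : Carrier) {ε : ℝ}, 0 < ε → ∃ a, proj a = x ∧ ‖a‖ < ‖x‖ + ε

/-- `A / J` as a bundled object. Projecting from this (non-reducible) bundle keeps type class
search from unfolding the construction. -/
@[irreducible] def quotPackage {A : Type u} [NonUnitalCStarAlgebra A] (J : ClosedIdeal A) : QuotPackage J where
  Carrier := J.PreQuot
  str := inferInstance
  proj := PreQuot.mk J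
  mk_surjective := PreQuot.mkₗ_surjective J
  mk_eq_zero := Submodule.Quotient.mk_eq_zero _
  exists_rep := PreQuot.exists_rep J

/-- The quotient C⋆-algebra `A / J`, with the quotient norm. -/
def Quot {A : Type u} [NonUnitalCStarAlgebra A] (J : ClosedIdeal A) : Type u :=
  (quotPackage J).Carrier

instance {A : Type u} [NonUnitalCStarAlgebra A] (J : ClosedIdeal A) :
    NonUnitalCStarAlgebra J.Quot := (quotPackage J).str

namespace Quot

/-- The quotient map `A → A / J`. -/
def mk : A →⋆ₙₐ[ℂ] J.Quot := (quotPackage J).proj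

theorem mk_surjective : Function.Surjective (mk J) := (quotPackage J).mk_surjective

theorem mk_eq_zero {a : A} : mk J a = 0 ↔ a ∈ J.carrier := (quotPackage J).mk_eq_zero

theorem mk_eq_mk {a b : A} : mk J a = mk J b ↔ a - b ∈ J.carrier := by
  rw [← sub_eq_zero, ← map_sub, mk_eq_zero]

theorem exists_rep (x : J.Quot) {ε : ℝ} (hε : 0 < ε) : ∃ a, mk J a = x ∧ ‖a‖ < ‖x‖ + ε :=
  (quotPackage J).exists_rep x hε

theorem norm_mk_le (a : A) : ‖mk J a‖ ≤ ‖a‖ := NonUnitalStarAlgHom.norm_apply_le _ a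

/-- A function constant on the classes modulo `J`, on `A / J`. -/
def fn {B : Type*} (φ : A → B) (x : J.Quot) : B := φ (Function.surjInv (mk_surjective J) x)

theorem fn_mk {B : Type*} {φ : A → B} (h : ∀ a b, a - b ∈ J.carrier → φ a = φ b) (a : A) :
    fn J φ (mk J a) = φ a :=
  h _ _ ((mk_eq_mk J).1 (Function.surjInv_eq (mk_surjective J) _))

theorem lift_aux {B : Type*} [NonUnitalCStarAlgebra B] (φ : A →⋆ₙₐ[ℂ] B)
    (h : ∀ a ∈ J.carrier, φ a = 0) (a : A) : fn J φ (mk J a) = φ a :=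
  fn_mk J (fun a b hab => by rw [← sub_eq_zero, ← map_sub, h _ hab]) a

/-- A `*`-homomorphism vanishing on `J` factors through `A / J`. -/
def lift {B : Type*} [NonUnitalCStarAlgebra B] (φ : A →⋆ₙₐ[ℂ] B)
    (h : ∀ a ∈ J.carrier, φ a = 0) : J.Quot →⋆ₙₐ[ℂ] B where
  toFun := fn J φ
  map_smul' c x := by
    obtain ⟨a, rfl⟩ := mk_surjective J x
    rw [← map_smul, lift_aux J φ h, lift_aux J φ h, map_smul]
    rfl
  map_zero' := by rw [← map_zero (mk J), lift_aux J φ h, map_zero]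
  map_add' x y := by
    obtain ⟨a, rfl⟩ := mk_surjective J x
    obtain ⟨b, rfl⟩ := mk_surjective J y
    rw [← map_add, lift_aux J φ h, lift_aux J φ h, lift_aux J φ h, map_add]
  map_mul' x y := by
    obtain ⟨a, rfl⟩ := mk_surjective J x
    obtain ⟨b, rfl⟩ := mk_surjective J y
    rw [← map_mul, lift_aux J φ h, lift_aux J φ h, lift_aux J φ h, map_mul]
  map_star' x := by
    obtain ⟨a, rfl⟩ := mk_surjective J x
    rw [← map_star, lift_aux J φ h, lift_aux J φ h, map_star]

@[simp] theorem lift_mk {B : Type*} [NonUnitalCStarAlgebra B] (φ : A →⋆ₙₐ[ℂ] B)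
    (h : ∀ a ∈ J.carrier, φ a = 0) (a : A) : lift J φ h (mk J a) = φ a := lift_aux J φ h a

theorem map_aux (φ : A →L[ℂ] A) (h : ∀ a ∈ J.carrier, φ a ∈ J.carrier) (a : A) :
    fn J (fun a => mk J (φ a)) (mk J a) = mk J (φ a) :=
  fn_mk J (fun a b hab => (mk_eq_mk J).2 (by rw [← map_sub]; exact h _ hab)) a

/-- The map induced on `A / J` by a bounded linear map preserving `J`. -/
def map (φ : A →L[ℂ] A) (h : ∀ a ∈ J.carrier, φ a ∈ J.carrier) : J.Quot →L[ℂ] J.Quot :=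
  LinearMap.mkContinuous
    { toFun := fn J fun a => mk J (φ a)
      map_add' := fun x y => by
        obtain ⟨a, rfl⟩ := mk_surjective J x
        obtain ⟨b, rfl⟩ := mk_surjective J y
        rw [← map_add, map_aux J φ h, map_aux J φ h, map_aux J φ h, map_add, map_add]
      map_smul' := fun c x => by
        obtain ⟨a, rfl⟩ := mk_surjective J x
        rw [← map_smul, map_aux J φ h, map_aux J φ h, map_smul, map_smul]
        rfl }
    ‖φ‖ fun x => by
      refine le_of_forall_pos_le_add fun ε hε => ?_
      obtain ⟨a, rfl, ha⟩ := exists_rep J x (show 0 < ε / (‖φ‖ + 1) by positivity)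
      calc ‖fn J (fun a => mk J (φ a)) (mk J a)‖ = ‖mk J (φ a)‖ := by rw [map_aux J φ h]
        _ ≤ ‖φ a‖ := norm_mk_le J _
        _ ≤ ‖φ‖ * ‖a‖ := φ.le_opNorm a
        _ ≤ ‖φ‖ * (‖mk J a‖ + ε / (‖φ‖ + 1)) := by gcongr
        _ = ‖φ‖ * ‖mk J a‖ + ‖φ‖ / (‖φ‖ + 1) * ε := by ring
        _ ≤ ‖φ‖ * ‖mk J a‖ + 1 * ε := by
          gcongr
          rw [div_le_one (by positivity)]
          linarith
        _ = _ := by rw [one_mul]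

theorem map_mk (φ : A →L[ℂ] A) (h : ∀ a ∈ J.carrier, φ a ∈ J.carrier) (a : A) :
    map J φ h (mk J a) = mk J (φ a) := map_aux J φ h a

end Quot

end ClosedIdeal

/-! ### C⋆-seminorms and the completion of a `*`-algebra -/

section CStarSeminorm

variable (T : Type*) [NonUnitalRing T] [StarRing T] [Module ℂ T]

/-- A (submultiplicative) C⋆-seminorm on a complex `*`-algebra. -/
structure CStarSeminorm extends Seminorm ℂ T where
  mul_le' : ∀ x y : T, toFun (x * y) ≤ toFun x * toFun y
  star_mul_self' : ∀ x : T, toFun (star x * x) = toFun x ^ 2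

variable {T}

theorem CStarSeminorm.star_le (p : CStarSeminorm T) (x : T) :
    p.toSeminorm (star x) = p.toSeminorm x := by
  have key : ∀ y : T, p.toSeminorm y ≤ p.toSeminorm (star y) := fun y => by
    have h1 : p.toSeminorm y ^ 2 ≤ p.toSeminorm (star y) * p.toSeminorm y :=
      (p.star_mul_self' y).symm.le.trans (p.mul_le' (star y) y)
    rcases (apply_nonneg p.toSeminorm y).eq_or_lt with h | h
    · rw [← h]; exact apply_nonneg p.toSeminorm _
    · rw [sq] at h1; exact le_of_mul_le_mul_right h1 h
  exact le_antisymm (by simpa using key (star x)) (key x)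

/-- The `*`-algebra `T`, regarded as seminormed by `p`. -/
def CStarSeminorm.Pre (_p : CStarSeminorm T) : Type _ := T

variable (p : CStarSeminorm T)

namespace CStarSeminorm.Pre

instance : NonUnitalRing p.Pre := inferInstanceAs (NonUnitalRing T)

instance : SeminormedAddCommGroup p.Pre :=
  AddGroupSeminorm.toSeminormedAddCommGroup (E := p.Pre) p.toSeminorm.toAddGroupSeminorm

instance : NonUnitalSeminormedRing p.Pre where
  __ := (inferInstance : NonUnitalRing p.Pre)
  __ := (inferInstance : SeminormedAddCommGroup p.Pre)
  norm_mul_le := p.mul_le'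

instance : StarRing p.Pre := inferInstanceAs (StarRing T)

instance : Module ℂ p.Pre := inferInstanceAs (Module ℂ T)

theorem norm_def (x : p.Pre) : ‖x‖ = p.toSeminorm x := rfl

instance : NormedSpace ℂ p.Pre where
  norm_smul_le c x := (map_smul_eq_mul p.toSeminorm c x).le

theorem norm_star_eq (x : p.Pre) : ‖star x‖ = ‖x‖ := p.star_le x

theorem norm_star_mul_self_eq (x : p.Pre) : ‖star x * x‖ = ‖x‖ ^ 2 := p.star_mul_self' x

theorem isometry_star : Isometry (star : p.Pre → p.Pre) :=
  Isometry.of_dist_eq fun x y => by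
    rw [dist_eq_norm, dist_eq_norm, ← star_sub, norm_star_eq]

end CStarSeminorm.Pre

/-- The Hausdorff completion of `T` with respect to `p`. -/
def CStarSeminorm.Completion : Type _ := UniformSpace.Completion p.Pre

namespace CStarSeminorm.Completion

open UniformSpace UniformSpace.Completion

instance : NormedAddCommGroup p.Completion :=
  inferInstanceAs (NormedAddCommGroup (UniformSpace.Completion p.Pre))
instance : NormedSpace ℂ p.Completion :=
  inferInstanceAs (NormedSpace ℂ (UniformSpace.Completion p.Pre))
instance : CompleteSpace p.Completion :=
  inferInstanceAs (CompleteSpace (UniformSpace.Completion p.Pre))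

/-- The canonical linear map into the completion. -/
def ofₗ : T →ₗ[ℂ] p.Completion where
  toFun x := ((show p.Pre from x : p.Pre) : UniformSpace.Completion p.Pre)
  map_add' x y := UniformSpace.Completion.coe_add (α := p.Pre) x y
  map_smul' c x := UniformSpace.Completion.coe_smul (X := p.Pre) c x

theorem norm_ofₗ (x : T) : ‖ofₗ p x‖ = p.toSeminorm x :=
  UniformSpace.Completion.norm_coe (E := p.Pre) x

theorem denseRange_ofₗ : DenseRange (ofₗ p) :=
  UniformSpace.Completion.denseRange_coe (α := p.Pre)

@[elab_as_elim]
theorem induct {P : p.Completion → Prop} (x : p.Completion) (hc : IsClosed {x | P x})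
    (h : ∀ t, P (ofₗ p t)) : P x :=
  isClosed_property (denseRange_ofₗ p) hc h x

instance : Mul p.Completion where
  mul := Function.curry <|
    ((isDenseInducing_coe (α := p.Pre)).prodMap (isDenseInducing_coe (α := p.Pre))).extend
      (fun z => ((z.1 * z.2 : p.Pre) : UniformSpace.Completion p.Pre))

theorem ofₗ_mul (x y : T) : ofₗ p (x * y) = ofₗ p x * ofₗ p y :=
  (((isDenseInducing_coe (α := p.Pre)).prodMap (isDenseInducing_coe (α := p.Pre))).extend_eq
    (f := fun z : p.Pre × p.Pre => ((z.1 * z.2 : p.Pre) : UniformSpace.Completion p.Pre))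
      ((continuous_coe p.Pre).comp continuous_mul) (x, y)).symm

instance : ContinuousMul p.Completion where
  continuous_mul := by
    let m := (AddMonoidHom.mul : p.Pre →+ p.Pre →+ p.Pre).compr₂ toCompl
    have : Continuous fun z : p.Pre × p.Pre => m z.1 z.2 :=
      (continuous_coe p.Pre).comp continuous_mul
    have di : IsDenseInducing (toCompl : p.Pre → UniformSpace.Completion p.Pre) :=
      isDenseInducing_coe
    exact (di.extend_Z_bilin di this :)

instance : Star p.Completion where
  star := UniformSpace.Completion.map (star : p.Pre → p.Pre)

theorem ofₗ_star (x : T) : ofₗ p (star x) = star (ofₗ p x) :=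
  (UniformSpace.Completion.map_coe (Pre.isometry_star p).uniformContinuous x).symm

instance : ContinuousStar p.Completion where
  continuous_star := UniformSpace.Completion.continuous_map

theorem aux_left_distrib (x y z : p.Completion) : x * (y + z) = x * y + x * z := by
  refine induct p x ?_ fun a => ?_
  · exact isClosed_eq (continuous_id.mul continuous_const) ((continuous_id.mul continuous_const).add (continuous_id.mul continuous_const))
  refine induct p y ?_ fun b => ?_
  · exact isClosed_eq
      (continuous_const.mul (continuous_id.add continuous_const)) ((continuous_const.mul continuous_id).add continuous_const)
  refine induct p z ?_ fun c => ?_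
  · exact isClosed_eq
      (continuous_const.mul (continuous_const.add continuous_id)) (continuous_const.add (continuous_const.mul continuous_id))
  simp only [← map_add, ← ofₗ_mul, mul_add]

theorem aux_right_distrib (x y z : p.Completion) : (x + y) * z = x * z + y * z := by
  refine induct p x ?_ fun a => ?_
  · exact isClosed_eq
      ((continuous_id.add continuous_const).mul continuous_const) ((continuous_id.mul continuous_const).add continuous_const)
  refine induct p y ?_ fun b => ?_
  · exact isClosed_eq
      ((continuous_const.add continuous_id).mul continuous_const) (continuous_const.add (continuous_id.mul continuous_const))
  refine induct p z ?_ fun c => ?_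
  · exact isClosed_eq (continuous_const.mul continuous_id) ((continuous_const.mul continuous_id).add (continuous_const.mul continuous_id))
  simp only [← map_add, ← ofₗ_mul, add_mul]

theorem aux_zero_mul (x : p.Completion) : 0 * x = 0 := by
  refine induct p x ?_ fun a => ?_
  · exact isClosed_eq (continuous_const.mul continuous_id) continuous_const
  rw [← map_zero (ofₗ p), ← ofₗ_mul, zero_mul]

theorem aux_mul_zero (x : p.Completion) : x * 0 = 0 := by
  refine induct p x ?_ fun a => ?_
  · exact isClosed_eq (continuous_id.mul continuous_const) continuous_const
  rw [← map_zero (ofₗ p), ← ofₗ_mul, mul_zero]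

theorem aux_mul_assoc (x y z : p.Completion) : x * y * z = x * (y * z) := by
  refine induct p x ?_ fun a => ?_
  · exact isClosed_eq ((continuous_id.mul continuous_const).mul continuous_const)
      (continuous_id.mul continuous_const)
  refine induct p y ?_ fun b => ?_
  · exact isClosed_eq ((continuous_const.mul continuous_id).mul continuous_const)
      (continuous_const.mul (continuous_id.mul continuous_const))
  refine induct p z ?_ fun c => ?_
  · exact isClosed_eq (continuous_const.mul continuous_id)
      (continuous_const.mul (continuous_const.mul continuous_id))
  simp only [← ofₗ_mul, mul_assoc]

instance : NonUnitalRing p.Completion where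
  __ := (inferInstance : AddCommGroup p.Completion)
  mul := (· * ·)
  left_distrib := aux_left_distrib p
  right_distrib := aux_right_distrib p
  zero_mul := aux_zero_mul p
  mul_zero := aux_mul_zero p
  mul_assoc := aux_mul_assoc p

instance : NonUnitalNormedRing p.Completion where
  __ := (inferInstance : NormedAddCommGroup p.Completion)
  __ := (inferInstance : NonUnitalRing p.Completion)
  norm_mul_le x y := by
    refine induct p x ?_ fun a => ?_
    · exact isClosed_le (continuous_id.mul continuous_const).norm (continuous_id.norm.mul continuous_const)
    refine induct p y ?_ fun b => ?_
    · exact isClosed_le (continuous_const.mul continuous_id).norm (continuous_const.mul continuous_id.norm)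
    have := p.mul_le' a b
    rw [← ofₗ_mul, norm_ofₗ, norm_ofₗ, norm_ofₗ]
    exact this

instance : StarRing p.Completion where
  star_involutive x := by
    refine induct p x ?_ fun a => ?_
    · exact isClosed_eq continuous_id.star.star continuous_id
    simp only [← ofₗ_star, star_star]
  star_mul x y := by
    refine induct p x ?_ fun a => ?_
    · exact isClosed_eq (continuous_id.mul continuous_const).star (continuous_const.mul continuous_id.star)
    refine induct p y ?_ fun b => ?_
    · exact isClosed_eq (continuous_const.mul continuous_id).star (continuous_id.star.mul continuous_const)
    simp only [← ofₗ_star, ← ofₗ_mul, star_mul]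
  star_add x y := by
    refine induct p x ?_ fun a => ?_
    · exact isClosed_eq (continuous_id.add continuous_const).star (continuous_id.star.add continuous_const)
    refine induct p y ?_ fun b => ?_
    · exact isClosed_eq (continuous_const.add continuous_id).star (continuous_const.add continuous_id.star)
    simp only [← ofₗ_star, ← map_add, star_add]

instance : CStarRing p.Completion where
  norm_mul_self_le x := by
    refine induct p x ?_ fun a => ?_
    · exact isClosed_le (continuous_id.norm.mul continuous_id.norm) (continuous_id.star.mul continuous_id).norm
    have := p.star_mul_self' a
    rw [← ofₗ_star, ← ofₗ_mul, norm_ofₗ, norm_ofₗ, ← sq]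
    exact this.symm.le

instance [IsScalarTower ℂ T T] [SMulCommClass ℂ T T] [StarModule ℂ T] :
    NonUnitalCStarAlgebra p.Completion where
  smul_assoc c x y := by
    simp only [smul_eq_mul]
    refine induct p x ?_ fun a => ?_
    · exact isClosed_eq ((continuous_id.const_smul c).mul continuous_const)
        ((continuous_id.mul continuous_const).const_smul c)
    refine induct p y ?_ fun b => ?_
    · exact isClosed_eq (continuous_const.mul continuous_id)
        ((continuous_const.mul continuous_id).const_smul c)
    simp only [← map_smul, ← ofₗ_mul, smul_mul_assoc]
  smul_comm c x y := by
    simp only [smul_eq_mul]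
    refine induct p x ?_ fun a => ?_
    · exact isClosed_eq ((continuous_id.mul continuous_const).const_smul c)
        (continuous_id.mul continuous_const)
    refine induct p y ?_ fun b => ?_
    · exact isClosed_eq ((continuous_const.mul continuous_id).const_smul c)
        (continuous_const.mul (continuous_id.const_smul c))
    simp only [← map_smul, ← ofₗ_mul, mul_smul_comm]
  star_smul c x := by
    refine induct p x ?_ fun a => ?_
    · exact isClosed_eq ((continuous_id.const_smul c).star) (continuous_id.star.const_smul (star c))
    simp only [← ofₗ_star, ← map_smul, star_smul]

/-- The canonical `*`-homomorphism into the completion. -/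
def of [IsScalarTower ℂ T T] [SMulCommClass ℂ T T] [StarModule ℂ T] :
    T →⋆ₙₐ[ℂ] p.Completion where
  __ := ofₗ p
  map_zero' := map_zero (ofₗ p)
  map_mul' := ofₗ_mul p
  map_star' := ofₗ_star p

end CStarSeminorm.Completion

section extend

variable {p} {D E : Type*} [NormedAddCommGroup D] [NormedSpace ℂ D]
  [NormedAddCommGroup E] [NormedSpace ℂ E] [CompleteSpace E]

/-- The extension of a `p`-bounded linear map `φ` along a `p`-isometric map `i`. -/
def CStarSeminorm.extend (i : T →ₗ[ℂ] D) (hi : ∀ t, ‖i t‖ = p.toSeminorm t)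
    (φ : T →ₗ[ℂ] E) (C : ℝ) (h : ∀ t, ‖φ t‖ ≤ C * p.toSeminorm t) : D →L[ℂ] E :=
  ContinuousLinearMap.extend
    (LinearMap.mkContinuous (show p.Pre →ₗ[ℂ] E from φ) C h)
    (LinearMap.mkContinuous (show p.Pre →ₗ[ℂ] D from i) 1 fun t =>
      ((hi t).trans (one_mul _).symm).le)

theorem CStarSeminorm.extend_apply (i : T →ₗ[ℂ] D) (hi : ∀ t, ‖i t‖ = p.toSeminorm t)
    (hd : DenseRange i) (φ : T →ₗ[ℂ] E) (C : ℝ) (h : ∀ t, ‖φ t‖ ≤ C * p.toSeminorm t) (t : T) :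
    CStarSeminorm.extend i hi φ C h (i t) = φ t :=
  ContinuousLinearMap.extend_eq
    (LinearMap.mkContinuous (show p.Pre →ₗ[ℂ] E from φ) C h)
    (e := LinearMap.mkContinuous (show p.Pre →ₗ[ℂ] D from i) 1 fun t =>
      ((hi t).trans (one_mul _).symm).le) hd
    (AddMonoidHomClass.isometry_of_norm (show p.Pre →ₗ[ℂ] D from i) hi).isUniformInducing
    (show p.Pre from t)

end extend

end CStarSeminorm

/-! ### The maximal tensor product -/

section MaxTensor

variable (A B : Type*) [NonUnitalCStarAlgebra A] [NonUnitalCStarAlgebra B]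

/-- The C⋆-seminorms `p` on the algebraic tensor product with `p (a ⊗ b) ≤ ‖a‖ ‖b‖`. The bound
holds for every C⋆-seminorm; it is imposed so that the supremum below is visibly finite. -/
def TensorSeminorm : Type _ :=
  {p : CStarSeminorm (A ⊗[ℂ] B) // ∀ a b, p.toSeminorm (a ⊗ₜ[ℂ] b) ≤ ‖a‖ * ‖b‖}

instance : Nonempty (TensorSeminorm A B) :=
  ⟨⟨{ toSeminorm := 0
      mul_le' := fun _ _ => (mul_zero (0 : ℝ)).ge
      star_mul_self' := fun _ => (zero_pow (M₀ := ℝ) two_ne_zero).symm }, fun a b => by simpa using by positivity⟩⟩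

variable {A B}

theorem bddAbove_tensorSeminorm (t : A ⊗[ℂ] B) :
    BddAbove (Set.range fun p : TensorSeminorm A B => p.1.toSeminorm t) := by
  suffices ∃ C, ∀ p : TensorSeminorm A B, p.1.toSeminorm t ≤ C by
    obtain ⟨C, hC⟩ := this
    exact ⟨C, by rintro _ ⟨p, rfl⟩; exact hC p⟩
  induction t with
  | zero => exact ⟨0, fun p => by simp⟩
  | tmul a b => exact ⟨_, fun p => p.2 a b⟩
  | add x y hx hy =>
    obtain ⟨C, hC⟩ := hx
    obtain ⟨D, hD⟩ := hy
    exact ⟨C + D, fun p => (map_add_le_add p.1.toSeminorm x y).trans (add_le_add (hC p) (hD p))⟩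

theorem le_iSup_tensorSeminorm (p : TensorSeminorm A B) (t : A ⊗[ℂ] B) :
    p.1.toSeminorm t ≤ ⨆ p : TensorSeminorm A B, p.1.toSeminorm t :=
  le_ciSup (bddAbove_tensorSeminorm t) p

theorem iSup_tensorSeminorm_nonneg (t : A ⊗[ℂ] B) :
    0 ≤ ⨆ p : TensorSeminorm A B, p.1.toSeminorm t :=
  Real.iSup_nonneg fun p => apply_nonneg p.1.toSeminorm t

variable (A B)

/-- The maximal C⋆-seminorm (in fact a norm) on the algebraic tensor product. -/
def maxSeminorm : CStarSeminorm (A ⊗[ℂ] B) where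
  toSeminorm := Seminorm.ofSMulLE (fun t => ⨆ p : TensorSeminorm A B, p.1.toSeminorm t)
    (by simp)
    (fun x y => ciSup_le fun p => (map_add_le_add p.1.toSeminorm x y).trans
      (add_le_add (le_iSup_tensorSeminorm p x) (le_iSup_tensorSeminorm p y)))
    (fun c x => ciSup_le fun p => by
      rw [map_smul_eq_mul]
      exact mul_le_mul_of_nonneg_left (le_iSup_tensorSeminorm p x) (norm_nonneg c))
  mul_le' x y := ciSup_le fun p => (p.1.mul_le' x y).trans
    (mul_le_mul (le_iSup_tensorSeminorm p x) (le_iSup_tensorSeminorm p y)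
      (apply_nonneg p.1.toSeminorm y) (iSup_tensorSeminorm_nonneg x))
  star_mul_self' x := by
    refine le_antisymm (ciSup_le fun p => ?_) ?_
    · refine (p.1.star_mul_self' x).le.trans ?_
      exact pow_le_pow_left₀ (apply_nonneg p.1.toSeminorm x) (le_iSup_tensorSeminorm p x) 2
    · have h : (⨆ p : TensorSeminorm A B, p.1.toSeminorm x) ≤
          √(⨆ p : TensorSeminorm A B, p.1.toSeminorm (star x * x)) :=
        ciSup_le fun p => Real.le_sqrt_of_sq_le
          ((p.1.star_mul_self' x).symm.le.trans (le_iSup_tensorSeminorm p (star x * x)))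
      calc _ ≤ √(⨆ p : TensorSeminorm A B, p.1.toSeminorm (star x * x)) ^ 2 :=
            pow_le_pow_left₀ (iSup_tensorSeminorm_nonneg x) h 2
        _ = _ := Real.sq_sqrt (iSup_tensorSeminorm_nonneg _)

variable {A B}

theorem le_maxSeminorm (p : TensorSeminorm A B) (t : A ⊗[ℂ] B) :
    p.1.toSeminorm t ≤ (maxSeminorm A B).toSeminorm t := le_iSup_tensorSeminorm p t

theorem maxSeminorm_tmul_le (a : A) (b : B) :
    (maxSeminorm A B).toSeminorm (a ⊗ₜ[ℂ] b) ≤ ‖a‖ * ‖b‖ := ciSup_le fun p => p.2 a b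

variable (A B)

/-- The maximal tensor product bundled with the map from the algebraic tensor product. -/
structure MaxTensorPackage (A : Type u) (B : Type v) [NonUnitalCStarAlgebra A]
    [NonUnitalCStarAlgebra B] : Type (max u v + 1) where
  Carrier : Type (max u v)
  str : NonUnitalCStarAlgebra Carrier
  of : A ⊗[ℂ] B →⋆ₙₐ[ℂ] Carrier
  norm_of : ∀ t, ‖of t‖ = (maxSeminorm A B).toSeminorm t
  denseRange_of : DenseRange of

/-- The completion of the algebraic tensor product in the maximal C⋆-norm, as a bundled object. -/
@[irreducible] def maxTensorPackage (A : Type u) (B : Type v) [NonUnitalCStarAlgebra A]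
    [NonUnitalCStarAlgebra B] : MaxTensorPackage A B where
  Carrier := (maxSeminorm A B).Completion
  str := inferInstance
  of := CStarSeminorm.Completion.of (maxSeminorm A B)
  norm_of := CStarSeminorm.Completion.norm_ofₗ (maxSeminorm A B)
  denseRange_of := CStarSeminorm.Completion.denseRange_ofₗ (maxSeminorm A B)

/-- The maximal tensor product `A ⊗_max B` of C⋆-algebras. -/
def MaxTensor (A : Type u) (B : Type v) [NonUnitalCStarAlgebra A] [NonUnitalCStarAlgebra B] :
    Type (max u v) := (maxTensorPackage A B).Carrier

instance : NonUnitalCStarAlgebra (MaxTensor A B) := (maxTensorPackage A B).str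

namespace MaxTensor

variable {A B}

/-- The canonical map from the algebraic tensor product. -/
def of : A ⊗[ℂ] B →⋆ₙₐ[ℂ] MaxTensor A B := (maxTensorPackage A B).of

theorem norm_of (t : A ⊗[ℂ] B) : ‖(of t : MaxTensor A B)‖ = (maxSeminorm A B).toSeminorm t :=
  (maxTensorPackage A B).norm_of t

theorem denseRange_of : DenseRange (of : A ⊗[ℂ] B → MaxTensor A B) :=
  (maxTensorPackage A B).denseRange_of

@[elab_as_elim]
theorem induct {P : MaxTensor A B → Prop} (x : MaxTensor A B) (hc : IsClosed {x | P x})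
    (h : ∀ t : A ⊗[ℂ] B, P (of t)) : P x :=
  isClosed_property denseRange_of hc h x

/-- Bounded linear maps extend from the algebraic tensor product. -/
def extend {E : Type*} [NormedAddCommGroup E] [NormedSpace ℂ E] [CompleteSpace E]
    (φ : A ⊗[ℂ] B →ₗ[ℂ] E) (C : ℝ) (h : ∀ t, ‖φ t‖ ≤ C * (maxSeminorm A B).toSeminorm t) :
    MaxTensor A B →L[ℂ] E :=
  CStarSeminorm.extend ((of : A ⊗[ℂ] B →⋆ₙₐ[ℂ] MaxTensor A B) : A ⊗[ℂ] B →ₗ[ℂ] MaxTensor A B) norm_of φ C h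

theorem extend_of {E : Type*} [NormedAddCommGroup E] [NormedSpace ℂ E] [CompleteSpace E]
    (φ : A ⊗[ℂ] B →ₗ[ℂ] E) (C : ℝ) (h : ∀ t, ‖φ t‖ ≤ C * (maxSeminorm A B).toSeminorm t)
    (t : A ⊗[ℂ] B) : extend φ C h (of t) = φ t :=
  CStarSeminorm.extend_apply ((of : A ⊗[ℂ] B →⋆ₙₐ[ℂ] MaxTensor A B) : A ⊗[ℂ] B →ₗ[ℂ] MaxTensor A B) norm_of
    denseRange_of φ C h t

section lift

variable {D : Type*} [NonUnitalCStarAlgebra D]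

theorem norm_le_maxSeminorm (φ : A ⊗[ℂ] B →⋆ₙₐ[ℂ] D)
    (h : ∀ a b, ‖φ (a ⊗ₜ[ℂ] b)‖ ≤ ‖a‖ * ‖b‖) (t : A ⊗[ℂ] B) : ‖φ t‖ ≤ (maxSeminorm A B).toSeminorm t :=
  le_maxSeminorm (⟨{
    toSeminorm := (normSeminorm ℂ D).comp (φ : A ⊗[ℂ] B →ₗ[ℂ] D)
    mul_le' := fun x y => by
      change ‖φ (x * y)‖ ≤ ‖φ x‖ * ‖φ y‖
      rw [map_mul]; exact norm_mul_le _ _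
    star_mul_self' := fun x => by
      change ‖φ (star x * x)‖ = ‖φ x‖ ^ 2
      rw [map_mul, map_star, CStarRing.norm_star_mul_self, sq] }, h⟩ : TensorSeminorm A B) t

/-- The universal property: extension of `*`-homomorphisms. -/
def lift (φ : A ⊗[ℂ] B →⋆ₙₐ[ℂ] D)
    (h : ∀ a b, ‖φ (a ⊗ₜ[ℂ] b)‖ ≤ ‖a‖ * ‖b‖) : MaxTensor A B →⋆ₙₐ[ℂ] D :=
  let ψ := extend (φ : A ⊗[ℂ] B →ₗ[ℂ] D) 1 fun t => by
    rw [one_mul]; exact norm_le_maxSeminorm φ h t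
  have hψ : ∀ t, ψ (of t) = φ t := extend_of _ _ _
  { toFun := ψ
    map_smul' := map_smul ψ
    map_zero' := map_zero ψ
    map_add' := map_add ψ
    map_mul' := fun x y => by
      refine induct x ?_ fun a => ?_
      · exact isClosed_eq (ψ.continuous.comp (continuous_id.mul continuous_const))
          (ψ.continuous.mul continuous_const)
      refine induct y ?_ fun b => ?_
      · exact isClosed_eq (ψ.continuous.comp (continuous_const.mul continuous_id))
          (continuous_const.mul ψ.continuous)
      rw [← map_mul, hψ, hψ, hψ, map_mul]
    map_star' := fun x => by
      refine induct x ?_ fun a => ?_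
      · exact isClosed_eq (ψ.continuous.comp continuous_star) ψ.continuous.star
      rw [← map_star, hψ, hψ, map_star] }

theorem lift_of (φ : A ⊗[ℂ] B →⋆ₙₐ[ℂ] D)
    (h : ∀ a b, ‖φ (a ⊗ₜ[ℂ] b)‖ ≤ ‖a‖ * ‖b‖) (t : A ⊗[ℂ] B) : lift φ h (of t) = φ t := extend_of _ _ _ t

end lift

end MaxTensor

end MaxTensor

/-! ### The action of a commutative `B` on `A ⊗_max B` -/

namespace MaxTensor

variable {A B : Type*} [NonUnitalCStarAlgebra A] [NonUnitalCStarAlgebra B]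

/-- The map `a ⊗ G ↦ a ⊗ F G` of the algebraic tensor product. -/
def algAct (F : B) : A ⊗[ℂ] B →ₗ[ℂ] A ⊗[ℂ] B :=
  LinearMap.lTensor A (LinearMap.mulLeft ℂ F)

@[simp] theorem algAct_tmul (F : B) (a : A) (G : B) :
    algAct F (a ⊗ₜ[ℂ] G) = a ⊗ₜ[ℂ] (F * G) := rfl

theorem star_algAct_mul (F : B) (x y : A ⊗[ℂ] B) :
    star (algAct F x) * algAct F y = star x * algAct (star F * F) y := by
  induction x with
  | zero => simp
  | add x x' hx hx' => simp only [map_add, star_add, add_mul, hx, hx']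
  | tmul a G =>
    induction y with
    | zero => simp
    | add y y' hy hy' => simp only [map_add, mul_add, hy, hy']
    | tmul b H =>
      simp only [algAct_tmul, TensorProduct.star_tmul, Algebra.TensorProduct.tmul_mul_tmul, star_mul]
      congr 1
      rw [mul_assoc, mul_assoc]

theorem exists_algAct_bound (t : A ⊗[ℂ] B) :
    ∃ C : ℝ, ∀ F : B, ‖F‖ ≤ 1 → (maxSeminorm A B).toSeminorm (algAct F t) ≤ C := by
  induction t with
  | zero => exact ⟨0, fun F _ => by simp⟩
  | tmul a G =>
    refine ⟨‖a‖ * ‖G‖, fun F hF => (maxSeminorm_tmul_le _ _).trans ?_⟩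
    have := (norm_mul_le F G).trans (mul_le_of_le_one_left (norm_nonneg G) hF)
    exact mul_le_mul_of_nonneg_left this (norm_nonneg a)
  | add x y hx hy =>
    obtain ⟨C, hC⟩ := hx
    obtain ⟨D, hD⟩ := hy
    exact ⟨C + D, fun F hF => by
      rw [map_add]
      exact (map_add_le_add _ _ _).trans (add_le_add (hC F hF) (hD F hF))⟩

theorem algAct_le_of_norm_le_one (F : B) (hF : ‖F‖ ≤ 1) (t : A ⊗[ℂ] B) :
    (maxSeminorm A B).toSeminorm (algAct F t) ≤
      (maxSeminorm A B).toSeminorm t := by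
  set p := maxSeminorm A B
  obtain ⟨C, hC⟩ := exists_algAct_bound t
  let Fs : ℕ → B := fun n => Nat.rec F (fun _ G => star G * G) n
  have hs : ∀ n, Fs (n + 1) = star (Fs n) * Fs n := fun n => rfl
  have hn : ∀ n, ‖Fs n‖ ≤ 1 := by
    intro n
    induction n with
    | zero => exact hF
    | succ n ih =>
      rw [hs, CStarRing.norm_star_mul_self]
      exact mul_le_one₀ ih (norm_nonneg _) ih
  set P := p.toSeminorm t
  let u : ℕ → ℝ := fun n => p.toSeminorm (algAct (Fs n) t)
  have hu0 : ∀ n, 0 ≤ u n := fun n => apply_nonneg p.toSeminorm _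
  have hu : ∀ n, u n ^ 2 ≤ P * u (n + 1) := fun n => by
    have h1 := p.star_mul_self' (algAct (Fs n) t)
    rw [star_algAct_mul] at h1
    have h2 := p.mul_le' (star t) (algAct (star (Fs n) * Fs n) t)
    have h3 := p.star_le t
    calc u n ^ 2 = _ := h1.symm
      _ ≤ _ := h2
      _ = P * u (n + 1) := by
        change p.toSeminorm (star t) * _ = _
        rw [h3]; rfl
  change u 0 ≤ P
  have hP0 : 0 ≤ P := apply_nonneg p.toSeminorm t
  rcases hP0.eq_or_lt with hP | hP
  · have := hu 0
    rw [← hP, zero_mul] at this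
    rw [← hP]
    exact (pow_eq_zero_iff two_ne_zero).mp (le_antisymm this (sq_nonneg _)) |>.le
  · by_contra hlt
    have hv : ∀ n, (u 0 / P) ^ (2 ^ n) ≤ u n / P := by
      intro n
      induction n with
      | zero => simp
      | succ n ih =>
        calc (u 0 / P) ^ (2 ^ (n + 1)) = ((u 0 / P) ^ (2 ^ n)) ^ 2 := by rw [pow_succ, pow_mul]
          _ ≤ (u n / P) ^ 2 := pow_le_pow_left₀ (by have := hu0 0; positivity) ih 2
          _ = u n ^ 2 / P ^ 2 := div_pow _ _ _
          _ ≤ P * u (n + 1) / P ^ 2 := by gcongr; exact hu n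
          _ = u (n + 1) / P := by field_simp
    have hgt : 1 < u 0 / P := (one_lt_div hP).mpr (not_le.mp hlt)
    obtain ⟨n, hn'⟩ := pow_unbounded_of_one_lt (C / P) hgt
    have h4 : (u 0 / P) ^ n ≤ (u 0 / P) ^ (2 ^ n) :=
      pow_le_pow_right₀ hgt.le (Nat.lt_two_pow_self).le
    have h5 : u n / P ≤ C / P := by gcongr; exact hC _ (hn n)
    exact absurd (h4.trans ((hv n).trans h5)) (not_le.mpr hn')

theorem algAct_le (F : B) (t : A ⊗[ℂ] B) :
    (maxSeminorm A B).toSeminorm (algAct F t) ≤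
      ‖F‖ * (maxSeminorm A B).toSeminorm t := by
  rcases eq_or_ne F 0 with rfl | hF
  · simp [algAct]
  · have hF' : ‖F‖ ≠ 0 := norm_ne_zero_iff.mpr hF
    have h1 := algAct_le_of_norm_le_one (A := A) ((‖F‖⁻¹ : ℂ) • F)
      (by rw [norm_smul]; simp [hF']) t
    have h2 : algAct F t = (‖F‖ : ℂ) • algAct ((‖F‖⁻¹ : ℂ) • F) t := by
      have : algAct (A := A) ((‖F‖⁻¹ : ℂ) • F) = (‖F‖⁻¹ : ℂ) • algAct F := by
        ext a G
        simp [smul_mul_assoc]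
      rw [this, LinearMap.smul_apply, smul_smul, mul_inv_cancel₀ (by exact_mod_cast hF'), one_smul]
    rw [h2, map_smul_eq_mul]
    simp only [Complex.norm_real, norm_norm]
    gcongr

/-- The action `a ⊗ G ↦ a ⊗ F G` of `F ∈ C₀(Y)` on `A ⊗_max C₀(Y)`. -/
def act (F : B) : MaxTensor A B →L[ℂ] MaxTensor A B :=
  extend ((of : A ⊗[ℂ] B →⋆ₙₐ[ℂ] _) ∘ₗ algAct F : A ⊗[ℂ] B →ₗ[ℂ] _) ‖F‖
    fun t => (norm_of _).le.trans (algAct_le F t)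

theorem act_of (F : B) (t : A ⊗[ℂ] B) : act F (of t) = of (algAct F t) :=
  extend_of _ _ _ t

theorem algAct_mul_eq (hB : ∀ b c : B, b * c = c * b) (F : B) (x y : A ⊗[ℂ] B) :
    algAct F x * y = x * algAct F y := by
  induction x with
  | zero => simp
  | add x x' hx hx' => simp only [map_add, add_mul, hx, hx']
  | tmul a G =>
    induction y with
    | zero => simp
    | add y y' hy hy' => simp only [map_add, mul_add, hy, hy']
    | tmul b H =>
      simp only [algAct_tmul, Algebra.TensorProduct.tmul_mul_tmul]
      rw [hB F G, mul_assoc]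

theorem act_mul_eq (hB : ∀ b c : B, b * c = c * b) (F : B) (x y : MaxTensor A B) :
    act F x * y = x * act F y := by
  refine induct x ?_ fun a => ?_
  · exact isClosed_eq ((act (A := A) F).continuous.mul continuous_const)
      (continuous_id.mul continuous_const)
  refine induct y ?_ fun b => ?_
  · exact isClosed_eq (continuous_const.mul continuous_id)
      (continuous_const.mul (act (A := A) F).continuous)
  rw [act_of, act_of, ← map_mul, ← map_mul, algAct_mul_eq hB]

theorem act_add (F G : B) (x : MaxTensor A B) :
    act (F + G) x = act F x + act G x := by
  refine induct x ?_ fun a => ?_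
  · exact isClosed_eq (act (A := A) (F + G)).continuous ((act (A := A) F).continuous.add (act (A := A) G).continuous)
  rw [act_of, act_of, act_of, ← map_add]
  congr 1
  induction a with
  | zero => simp
  | tmul a G => simp [add_mul, TensorProduct.tmul_add]
  | add x y hx hy => simp only [map_add, hx, hy]; abel

theorem act_smul (c : ℂ) (F : B) (x : MaxTensor A B) :
    act (c • F) x = c • act F x := by
  refine induct x ?_ fun a => ?_
  · exact isClosed_eq (act (A := A) (c • F)).continuous ((act (A := A) F).continuous.const_smul c)
  rw [act_of, act_of, ← map_smul]
  congr 1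
  induction a with
  | zero => simp
  | tmul a G => simp [smul_mul_assoc]
  | add x y hx hy => simp only [map_add, hx, hy, smul_add]

theorem act_act (F G : B) (x : MaxTensor A B) :
    act (F * G) x = act F (act G x) := by
  refine induct x ?_ fun a => ?_
  · exact isClosed_eq (act (A := A) (F * G)).continuous ((act (A := A) F).continuous.comp (act (A := A) G).continuous)
  rw [act_of, act_of, act_of]
  congr 1
  induction a with
  | zero => simp
  | tmul a G => simp [mul_assoc]
  | add x y hx hy => simp only [map_add, hx, hy]

theorem act_star (hB : ∀ b c : B, b * c = c * b) (F : B) (x : MaxTensor A B) :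
    act (star F) (star x) = star (act F x) := by
  refine induct x ?_ fun a => ?_
  · exact isClosed_eq ((act (A := A) (star F)).continuous.comp continuous_star) (act (A := A) F).continuous.star
  rw [← map_star, act_of, act_of, ← map_star]
  congr 1
  induction a with
  | zero => simp
  | tmul a G => simp [hB (star F)]
  | add x y hx hy => simp only [map_add, star_add, hx, hy]

/-! #### Elementary tensors -/

/-- The elementary tensor `a ⊗ b` in `A ⊗_max B`. -/
def tmul (a : A) (b : B) : MaxTensor A B := of (a ⊗ₜ[ℂ] b)

theorem tmul_mul_tmul (a a' : A) (b b' : B) : tmul a b * tmul a' b' = tmul (a * a') (b * b') := by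
  rw [tmul, tmul, ← map_mul, Algebra.TensorProduct.tmul_mul_tmul, tmul]

theorem star_tmul (a : A) (b : B) : star (tmul a b) = tmul (star a) (star b) := by
  rw [tmul, ← map_star, TensorProduct.star_tmul, tmul]

theorem tmul_sub (a : A) (b b' : B) : tmul a (b - b') = tmul a b - tmul a b' := by
  rw [tmul, TensorProduct.tmul_sub, map_sub, tmul, tmul]

theorem add_tmul (a a' : A) (b : B) : tmul (a + a') b = tmul a b + tmul a' b := by
  rw [tmul, TensorProduct.add_tmul, map_add, tmul, tmul]

theorem smul_tmul (c : ℂ) (a : A) (b : B) : tmul (c • a) b = c • tmul a b := by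
  rw [tmul, ← TensorProduct.smul_tmul', map_smul, tmul]

theorem tmul_smul (c : ℂ) (a : A) (b : B) : tmul a (c • b) = c • tmul a b := by
  rw [tmul, TensorProduct.tmul_smul, map_smul, tmul]

theorem zero_tmul (b : B) : tmul (0 : A) b = 0 := by
  rw [tmul, TensorProduct.zero_tmul, map_zero]

theorem norm_tmul_le (a : A) (b : B) : ‖tmul a b‖ ≤ ‖a‖ * ‖b‖ :=
  (norm_of _).le.trans (maxSeminorm_tmul_le a b)

theorem act_tmul (b : B) (a : A) (b' : B) : act b (tmul a b') = tmul a (b * b') := by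
  rw [tmul, act_of, algAct_tmul, tmul]

variable (A B) in
theorem dense_span_tmul :
    Dense (Submodule.span ℂ {t : MaxTensor A B | ∃ a b, t = tmul a b} : Set (MaxTensor A B)) := by
  refine (denseRange_of (A := A) (B := B)).mono ?_
  rintro _ ⟨t, rfl⟩
  induction t with
  | zero => simp
  | tmul a F => exact Submodule.subset_span ⟨a, F, rfl⟩
  | add x y hx hy =>
    rw [map_add]
    exact Submodule.add_mem _ hx hy

section evalHom

variable {D : Type*} [NonUnitalCStarAlgebra D]

/-- The `*`-homomorphism `a ⊗ b ↦ χ(b) φ(a)` of the algebraic tensor product. -/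
def algEval (χ : B →⋆ₙₐ[ℂ] ℂ) (φ : A →⋆ₙₐ[ℂ] D) : A ⊗[ℂ] B →⋆ₙₐ[ℂ] D :=
  let ψ : A ⊗[ℂ] B →ₗ[ℂ] D :=
    TensorProduct.lift (LinearMap.mk₂ ℂ (fun (a : A) (b : B) => χ b • φ a)
      (fun a b F => by rw [map_add, smul_add]) (fun c a F => by rw [map_smul, smul_comm])
      (fun a F G => by rw [map_add, add_smul]) (fun c a F => by rw [map_smul, smul_assoc]))
  have hψ : ∀ a b, ψ (a ⊗ₜ[ℂ] b) = χ b • φ a := fun _ _ => rfl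
  { toFun := ψ
    map_smul' := map_smul ψ
    map_zero' := map_zero ψ
    map_add' := map_add ψ
    map_mul' := fun s t => by
      induction s with
      | zero => rw [map_zero, zero_mul, zero_mul, map_zero]
      | add s s' hs hs' => rw [map_add, add_mul, add_mul, map_add, hs, hs']
      | tmul a F =>
        induction t with
        | zero => rw [map_zero, mul_zero, mul_zero, map_zero]
        | add s s' hs hs' => rw [map_add, mul_add, mul_add, map_add, hs, hs']
        | tmul b G =>
          rw [Algebra.TensorProduct.tmul_mul_tmul, hψ, hψ, hψ, map_mul, map_mul,
            smul_mul_smul_comm]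
    map_star' := fun s => by
      induction s with
      | zero => rw [star_zero, map_zero, star_zero]
      | add s s' hs hs' => rw [star_add, map_add, map_add, hs, hs', star_add]
      | tmul a F =>
        rw [TensorProduct.star_tmul, hψ, hψ, map_star, map_star, star_smul] }

/-- The `*`-homomorphism `a ⊗ b ↦ χ(b) φ(a)` of `A ⊗_max B`. -/
def evalHom (χ : B →⋆ₙₐ[ℂ] ℂ) (φ : A →⋆ₙₐ[ℂ] D) : MaxTensor A B →⋆ₙₐ[ℂ] D :=
  lift (algEval χ φ) fun a b => by
    change ‖χ b • φ a‖ ≤ _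
    rw [norm_smul, mul_comm]
    exact mul_le_mul (NonUnitalStarAlgHom.norm_apply_le φ a) (NonUnitalStarAlgHom.norm_apply_le χ b)
      (norm_nonneg _) (norm_nonneg _)

theorem evalHom_tmul (χ : B →⋆ₙₐ[ℂ] ℂ) (φ : A →⋆ₙₐ[ℂ] D) (a : A) (b : B) :
    evalHom χ φ (tmul a b) = χ b • φ a := lift_of _ _ _

end evalHom

end MaxTensor

/-! ### `C₀(X)`-algebras, their fibres and the bundle `A^♯` -/

/-- A `C₀(X)`-algebra structure on the C⋆-algebra `A`: a `*`-homomorphism from `C₀(X)` into the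
centre of the multiplier algebra of `A` such that `θ(C₀(X)) A` spans a dense subspace of `A`
(equivalently, by Cohen factorization, `θ(C₀(X)) A = A`). -/
class C0Algebra (X A : Type*) [TopologicalSpace X] [NonUnitalCStarAlgebra A] where
  /-- the structure homomorphism -/
  θ : C₀(X, ℂ) →⋆ₙₐ[ℂ] 𝓜(ℂ, A)
  central : ∀ (f : C₀(X, ℂ)) (m : 𝓜(ℂ, A)), θ f * m = m * θ f
  nondegenerate : Dense (Submodule.span ℂ {b : A | ∃ f a, b = (θ f).fst a} : Set A)

namespace C0Algebra

variable {X : Type*} (A : Type*) [TopologicalSpace X] [NonUnitalCStarAlgebra A] [C0Algebra X A]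

variable {A} in
/-- The module action `f · a = θ(f) a` of `C₀(X)` on `A`. -/
def act (f : C₀(X, ℂ)) : A →L[ℂ] A := (θ f : 𝓜(ℂ, A)).fst

/-- The closed ideal `I_x A`, where `I_x = {f ∈ C₀(X) | f x = 0}`. -/
def fibreIdeal (x : X) : ClosedIdeal A :=
  ClosedIdeal.span {b | ∃ (f : C₀(X, ℂ)) (a : A), f x = 0 ∧ b = act f a}

/-- The fibre `A_x = A / I_x A`. -/
abbrev Fibre (x : X) : Type _ := (fibreIdeal A x).Quot

variable {A} in
/-- The image `a_x` of `a` in the fibre `A_x`. -/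
def germ (x : X) : A →⋆ₙₐ[ℂ] Fibre A x := ClosedIdeal.Quot.mk (fibreIdeal A x)

theorem germ_surjective (x : X) : Function.Surjective (germ x : A → Fibre A x) :=
  ClosedIdeal.Quot.mk_surjective _

variable {A}

theorem act_add (f g : C₀(X, ℂ)) (a : A) : act (f + g) a = act f a + act g a := by
  simp [act]

theorem act_sub (f g : C₀(X, ℂ)) (a : A) : act (f - g) a = act f a - act g a := by
  simp [act]

theorem act_smul (c : ℂ) (f : C₀(X, ℂ)) (a : A) : act (c • f) a = c • act f a := by
  simp [act]

theorem act_mul (f g : C₀(X, ℂ)) (a : A) : act (f * g) a = act f (act g a) := by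
  simp [act]

theorem germ_act_eq_zero {x : X} {f : C₀(X, ℂ)} (hf : f x = 0) (a : A) : germ x (act f a) = 0 :=
  (ClosedIdeal.Quot.mk_eq_zero _).mpr (ClosedIdeal.subset_span _ ⟨f, a, hf, rfl⟩)

theorem germ_act (x : X) (f : C₀(X, ℂ)) (a : A) : germ x (act f a) = f x • germ x a := by
  have hcl : IsClosed {a : A | germ x (act f a) = f x • germ x a} :=
    isClosed_eq ((continuous_starHom (germ x)).comp (act f).continuous)
      ((continuous_starHom (germ x)).const_smul (f x))
  refine hcl.closure_subset_iff.mpr ?_ (nondegenerate (X := X) (A := A) a)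
  intro b hb
  induction hb using Submodule.span_induction with
  | mem b hb =>
    obtain ⟨g, c, rfl⟩ := hb
    change germ x (act f (act g c)) = f x • germ x (act g c)
    rw [← sub_eq_zero, ← map_smul, ← map_sub, ← act_mul, ← act_smul, ← act_sub]
    exact germ_act_eq_zero (by simp) c
  | zero => simp
  | add b c _ _ hb hc =>
    simp only [Set.mem_ofPred_eq] at hb hc ⊢
    rw [map_add, map_add, map_add, hb, hc, smul_add]
  | smul k b _ hb =>
    simp only [Set.mem_ofPred_eq] at hb ⊢
    rw [map_smul, map_smul, map_smul, hb, smul_comm]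

end C0Algebra

/-- The total space `⊔ₓ E x` of a family over `X`. -/
structure BundleTotal {X : Type*} (E : X → Type*) where
  /-- the base point -/
  pt : X
  /-- the element of the fibre -/
  val : E pt

/-- The bundle `A^♯ = ⊔ₓ A_x`. -/
abbrev Sharp (X A : Type*) [TopologicalSpace X] [NonUnitalCStarAlgebra A] [C0Algebra X A] :
    Type _ := BundleTotal fun x : X => C0Algebra.Fibre A x

/-- The topology of `A^♯`, generated by the sets
`U(a, ε) = {z ∈ A_x | x ∈ U, ‖z - a_x‖ < ε}`, `U ⊆ X` open, `a ∈ A`, `ε > 0`. -/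
instance Sharp.instTopologicalSpace (X A : Type*) [TopologicalSpace X] [NonUnitalCStarAlgebra A]
    [C0Algebra X A] : TopologicalSpace (Sharp X A) :=
  TopologicalSpace.generateFrom
    {S | ∃ (U : Set X) (a : A) (ε : ℝ), IsOpen U ∧ 0 < ε ∧
      S = {z : Sharp X A | z.pt ∈ U ∧ ‖z.val - C0Algebra.germ z.pt a‖ < ε}}

/-! ### Central multipliers -/

section CentralMultiplier

variable {A : Type*} [NonUnitalCStarAlgebra A]

/-- The multiplier given by a bounded map `T` with `T x * y = x * T y`. -/
def centralMultiplier (T : A →L[ℂ] A) (hT : ∀ x y, T x * y = x * T y) : 𝓜(ℂ, A) where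
  toProd := (T, T)
  central := hT

theorem eq_of_forall_mul_right {x y : A} (h : ∀ z, x * z = y * z) : x = y := by
  rw [← sub_eq_zero, ← CStarRing.mul_star_self_eq_zero_iff, sub_mul, h, sub_self]

theorem eq_of_forall_mul_left {x y : A} (h : ∀ z, z * x = z * y) : x = y := by
  rw [← sub_eq_zero, ← CStarRing.star_mul_self_eq_zero_iff, mul_sub, h, sub_self]

theorem fst_mul_apply (m : 𝓜(ℂ, A)) (x y : A) : m.fst (x * y) = m.fst x * y :=
  eq_of_forall_mul_left fun z => by
    rw [← m.central, ← mul_assoc, m.central, mul_assoc]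

theorem snd_mul_apply (m : 𝓜(ℂ, A)) (x y : A) : m.snd (x * y) = x * m.snd y :=
  eq_of_forall_mul_right fun z => by
    rw [m.central, mul_assoc, ← m.central, mul_assoc]

theorem centralMultiplier_comm (T : A →L[ℂ] A) (hT : ∀ x y, T x * y = x * T y) (m : 𝓜(ℂ, A)) :
    centralMultiplier T hT * m = m * centralMultiplier T hT := by
  have h1 : ∀ x, T (m.fst x) = m.fst (T x) := fun x => eq_of_forall_mul_right fun z => by
    rw [hT, ← fst_mul_apply, ← hT, fst_mul_apply]
  have h2 : ∀ x, T (m.snd x) = m.snd (T x) := fun x => eq_of_forall_mul_left fun z => by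
    rw [← hT, ← snd_mul_apply, hT, snd_mul_apply]
  refine DoubleCentralizer.ext _ _ _ _ (Prod.ext (ContinuousLinearMap.ext fun x => ?_)
    (ContinuousLinearMap.ext fun x => ?_))
  · simpa using! h1 x
  · simpa using! (h2 x).symm

/-- The `*`-homomorphism into the multiplier algebra given by an action by central multipliers. -/
def centralHom {B : Type*} [NonUnitalNormedCommRing B] [NormedSpace ℂ B] [StarRing B]
    (T : B → A →L[ℂ] A) (hT : ∀ b x y, T b x * y = x * T b y)
    (hsmul : ∀ (c : ℂ) b x, T (c • b) x = c • T b x) (hadd : ∀ b b' x, T (b + b') x = T b x + T b' x)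
    (hmul : ∀ b b' x, T (b * b') x = T b (T b' x))
    (hstar : ∀ b x, T (star b) (star x) = star (T b x)) : B →⋆ₙₐ[ℂ] 𝓜(ℂ, A) where
  toFun := fun b => centralMultiplier (T b) (hT b)
  map_smul' := fun c b =>
    DoubleCentralizer.ext _ _ _ _ (Prod.ext (ContinuousLinearMap.ext fun x => hsmul c b x)
      (ContinuousLinearMap.ext fun x => hsmul c b x))
  map_zero' := by
    have h : ∀ x, T 0 x = 0 := fun x => by rw [← zero_smul ℂ (0 : B), hsmul, zero_smul]
    exact DoubleCentralizer.ext _ _ _ _ (Prod.ext (ContinuousLinearMap.ext fun x => h x)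
      (ContinuousLinearMap.ext fun x => h x))
  map_add' := fun b b' =>
    DoubleCentralizer.ext _ _ _ _ (Prod.ext (ContinuousLinearMap.ext fun x => hadd b b' x)
      (ContinuousLinearMap.ext fun x => hadd b b' x))
  map_mul' := fun b b' =>
    DoubleCentralizer.ext _ _ _ _ (Prod.ext (ContinuousLinearMap.ext fun x => hmul b b' x)
      (ContinuousLinearMap.ext fun x => by
        change T (b * b') x = T b' (T b x)
        rw [mul_comm, hmul]))
  map_star' := fun b => by
    have h : ∀ x, T (star b) x = star (T b (star x)) := fun x => by rw [← hstar, star_star]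
    exact DoubleCentralizer.ext _ _ _ _ (Prod.ext (ContinuousLinearMap.ext fun x => h x)
      (ContinuousLinearMap.ext fun x => h x))

end CentralMultiplier

/-! ### The pullback `q^*A = A ⊗_{C₀(X)} C₀(Y)` -/

section Pullback

variable {X Y : Type*} (A : Type*) [TopologicalSpace X] [TopologicalSpace Y]
  [NonUnitalCStarAlgebra A] [C0Algebra X A]

/-- The function `(f ∘ q) F ∈ C₀(Y)`, for `f ∈ C₀(X)` and `F ∈ C₀(Y)`. -/
def pullMul (q : C(Y, X)) (f : C₀(X, ℂ)) (F : C₀(Y, ℂ)) : C₀(Y, ℂ) where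
  toFun y := f (q y) * F y
  continuous_toFun := by fun_prop
  zero_at_infty' := by
    refine squeeze_zero_norm (a := fun y => ‖f‖ * ‖F y‖) (fun y => ?_) ?_
    · rw [norm_mul]
      gcongr
      exact f.toBCF.norm_coe_le_norm (q y)
    · simpa using (F.zero_at_infty'.norm).const_mul ‖f‖

/-- The closed ideal of `A ⊗_max C₀(Y)` generated by the differences
`f a ⊗ F - a ⊗ (f ∘ q) F`. -/
def balancedIdeal (q : C(Y, X)) : ClosedIdeal (MaxTensor A C₀(Y, ℂ)) :=
  ClosedIdeal.span {d | ∃ (f : C₀(X, ℂ)) (a : A) (F : C₀(Y, ℂ)),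
    d = MaxTensor.tmul (C0Algebra.act f a) F - MaxTensor.tmul a (pullMul q f F)}

/-- The pullback `q^*A = A ⊗_{C₀(X), q} C₀(Y)`: the maximal `C₀(X)`-balanced tensor product. -/
abbrev Pullback (q : C(Y, X)) : Type _ := (balancedIdeal A q).Quot

namespace Pullback

variable {A}

/-- The class of the elementary tensor `a ⊗ F` in `q^*A`. -/
def tmul (q : C(Y, X)) (a : A) (F : C₀(Y, ℂ)) : Pullback A q :=
  ClosedIdeal.Quot.mk _ (MaxTensor.tmul a F)

theorem c0_mul_comm (F G : C₀(Y, ℂ)) : F * G = G * F := mul_comm F G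

theorem act_mul_right (F : C₀(Y, ℂ)) (x y : MaxTensor A C₀(Y, ℂ)) :
    MaxTensor.act F (x * y) = x * MaxTensor.act F y :=
  eq_of_forall_mul_right fun z => by
    rw [MaxTensor.act_mul_eq c0_mul_comm, mul_assoc, mul_assoc, MaxTensor.act_mul_eq c0_mul_comm]

theorem act_mem (q : C(Y, X)) (F : C₀(Y, ℂ)) {d : MaxTensor A C₀(Y, ℂ)}
    (hd : d ∈ (balancedIdeal A q).carrier) :
    MaxTensor.act F d ∈ (balancedIdeal A q).carrier := by
  let J := balancedIdeal A q
  let N : ClosedIdeal (MaxTensor A C₀(Y, ℂ)) :=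
    { carrier := {d | ∀ F, MaxTensor.act F d ∈ J.carrier}
      add_mem' := fun {a b} ha hb F => by rw [map_add]; exact J.add_mem' (ha F) (hb F)
      zero_mem' := fun F => by rw [map_zero]; exact J.zero_mem'
      smul_mem' := fun c a ha F => by rw [map_smul]; exact J.smul_mem' c (ha F)
      mul_left_mem := fun a b hb F => by
        rw [act_mul_right]
        exact J.mul_left_mem a (hb F)
      mul_right_mem := fun {a} b ha F => by
        rw [act_mul_right, ← MaxTensor.act_mul_eq c0_mul_comm]
        exact J.mul_right_mem b (ha F)
      star_mem := fun {a} ha F => by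
        rw [← star_star F, MaxTensor.act_star c0_mul_comm]
        exact J.star_mem (ha _)
      isClosed := by
        simp only [Set.ofPred_forall]
        exact isClosed_iInter fun F => J.isClosed.preimage (MaxTensor.act (A := A) F).continuous }
  refine ClosedIdeal.span_le (J := N) ?_ hd F
  rintro _ ⟨f, a, G, rfl⟩ F
  refine ClosedIdeal.subset_span _ ⟨f, a, F * G, ?_⟩
  rw [map_sub, MaxTensor.act_tmul, MaxTensor.act_tmul]
  congr 2
  ext y
  simp [pullMul]
  ring

/-- The action `F' · (a ⊗ F) = a ⊗ F' F` of `C₀(Y)` on `q^*A`. -/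
def act (q : C(Y, X)) (F : C₀(Y, ℂ)) : Pullback A q →L[ℂ] Pullback A q :=
  ClosedIdeal.Quot.map _ (MaxTensor.act F) fun _ hd => act_mem q F hd

theorem act_mk (q : C(Y, X)) (F : C₀(Y, ℂ)) (d : MaxTensor A C₀(Y, ℂ)) :
    act q F (ClosedIdeal.Quot.mk _ d) = ClosedIdeal.Quot.mk _ (MaxTensor.act F d) :=
  ClosedIdeal.Quot.map_mk _ _ _ d

theorem act_tmul (q : C(Y, X)) (F : C₀(Y, ℂ)) (a : A) (G : C₀(Y, ℂ)) :
    act q F (tmul q a G) = tmul q a (F * G) := by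
  rw [tmul, act_mk, MaxTensor.act_tmul, tmul]

theorem act_mul_eq (q : C(Y, X)) (F : C₀(Y, ℂ)) (x y : Pullback A q) :
    act q F x * y = x * act q F y := by
  obtain ⟨a, rfl⟩ := ClosedIdeal.Quot.mk_surjective _ x
  obtain ⟨b, rfl⟩ := ClosedIdeal.Quot.mk_surjective _ y
  rw [act_mk, act_mk, ← map_mul, ← map_mul, MaxTensor.act_mul_eq c0_mul_comm]

variable (A) in
/-- The finite sums of elementary tensors are dense in `q^*A`. -/
theorem dense_span_tmul (q : C(Y, X)) :
    Dense (Submodule.span ℂ {t : Pullback A q | ∃ a F, t = tmul q a F} : Set (Pullback A q)) := by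
  have h1 := ((ClosedIdeal.Quot.mk_surjective (balancedIdeal A q)).denseRange).dense_image
    (continuous_starHom _) (MaxTensor.dense_span_tmul A C₀(Y, ℂ))
  refine h1.mono ?_
  rintro _ ⟨t, ht, rfl⟩
  induction ht using Submodule.span_induction with
  | mem t ht =>
    obtain ⟨a, F, rfl⟩ := ht
    exact Submodule.subset_span ⟨a, F, rfl⟩
  | zero => rw [map_zero]; exact Submodule.zero_mem _
  | add x y _ _ hx hy => rw [map_add]; exact Submodule.add_mem _ hx hy
  | smul c x _ hx => rw [map_smul]; exact Submodule.smul_mem _ c hx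

theorem norm_tmul_le (q : C(Y, X)) (a : A) (F : C₀(Y, ℂ)) : ‖tmul q a F‖ ≤ ‖a‖ * ‖F‖ :=
  (NonUnitalStarAlgHom.norm_apply_le _ _).trans (MaxTensor.norm_tmul_le a F)

theorem tmul_sub (q : C(Y, X)) (a : A) (F G : C₀(Y, ℂ)) :
    tmul q a (F - G) = tmul q a F - tmul q a G := by
  rw [tmul, tmul, tmul, MaxTensor.tmul_sub, map_sub]

theorem exists_norm_tmul_lt (q : C(Y, X)) (a : A) (F : C₀(Y, ℂ)) {ε : ℝ} (hε : 0 < ε) :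
    ∃ G, ‖tmul q a F - tmul q a (F * G)‖ < ε := by
  obtain ⟨b, -, hb⟩ := ClosedIdeal.exists_approx_unit F
    (show 0 < ε / (‖a‖ + 1) by positivity)
  refine ⟨star b * b, ?_⟩
  rw [norm_sub_rev] at hb
  rw [← tmul_sub]
  calc _ ≤ ‖a‖ * ‖F - F * (star b * b)‖ := norm_tmul_le _ _ _
    _ ≤ ‖a‖ * (ε / (‖a‖ + 1)) := by gcongr
    _ < ε := by
      rw [mul_div_assoc', div_lt_iff₀ (by positivity)]
      nlinarith [norm_nonneg a]

/-- The structure homomorphism `F' ↦ (a ⊗ F ↦ a ⊗ F' F)` of `q^*A`. -/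
def structureHom (q : C(Y, X)) : C₀(Y, ℂ) →⋆ₙₐ[ℂ] 𝓜(ℂ, Pullback A q) :=
  centralHom (act q) (act_mul_eq q)
    (fun c F x => by
      obtain ⟨d, rfl⟩ := ClosedIdeal.Quot.mk_surjective _ x
      rw [act_mk, act_mk, MaxTensor.act_smul, map_smul])
    (fun F G x => by
      obtain ⟨d, rfl⟩ := ClosedIdeal.Quot.mk_surjective _ x
      rw [act_mk, act_mk, act_mk, MaxTensor.act_add, map_add])
    (fun F G x => by
      obtain ⟨d, rfl⟩ := ClosedIdeal.Quot.mk_surjective _ x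
      rw [act_mk, act_mk, act_mk, MaxTensor.act_act])
    (fun F x => by
      obtain ⟨d, rfl⟩ := ClosedIdeal.Quot.mk_surjective _ x
      rw [← map_star, act_mk, act_mk, MaxTensor.act_star c0_mul_comm, map_star])

theorem dense_act (q : C(Y, X)) : Dense (Submodule.span ℂ
    {b : Pullback A q | ∃ F a, b = act q F a} : Set (Pullback A q)) := by
  rw [← dense_closure]
  refine (dense_span_tmul A q).mono ?_
  rw [← Submodule.topologicalClosure_coe]
  refine Submodule.span_le.mpr ?_
  rintro _ ⟨a, F, rfl⟩
  rw [Submodule.topologicalClosure_coe]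
  refine Metric.mem_closure_iff.mpr fun ε hε => ?_
  obtain ⟨G, hG⟩ := exists_norm_tmul_lt q a F hε
  refine ⟨act q F (tmul q a G), Submodule.subset_span ⟨F, _, rfl⟩, ?_⟩
  rw [act_tmul, dist_eq_norm]
  exact hG

/-- The canonical `C₀(Y)`-algebra structure of `q^*A`. -/
instance (q : C(Y, X)) : C0Algebra Y (Pullback A q) where
  θ := structureHom q
  central _ m := centralMultiplier_comm _ _ m
  nondegenerate := dense_act q

/-! #### The identification `(q^*A)_y = A_{q(y)}` -/

/-- The point evaluation of `C₀(Y)` at `y`. -/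
def pointEval (y : Y) : C₀(Y, ℂ) →⋆ₙₐ[ℂ] ℂ where
  toFun F := F y
  map_smul' _ _ := rfl
  map_zero' := rfl
  map_add' _ _ := rfl
  map_mul' _ _ := rfl
  map_star' _ := rfl

/-- Evaluation `a ⊗ F ↦ F(y) a_{q(y)}` on `A ⊗_max C₀(Y)`. -/
def maxEval (q : C(Y, X)) (y : Y) : MaxTensor A C₀(Y, ℂ) →⋆ₙₐ[ℂ] C0Algebra.Fibre A (q y) :=
  MaxTensor.evalHom (pointEval y) (C0Algebra.germ (q y))

theorem maxEval_tmul (q : C(Y, X)) (y : Y) (a : A) (F : C₀(Y, ℂ)) :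
    maxEval q y (MaxTensor.tmul a F) = F y • C0Algebra.germ (q y) a :=
  MaxTensor.evalHom_tmul _ _ a F

/-- Evaluation `a ⊗ F ↦ F(y) a_{q(y)}` on `q^*A`. -/
def eval (q : C(Y, X)) (y : Y) : Pullback A q →⋆ₙₐ[ℂ] C0Algebra.Fibre A (q y) :=
  ClosedIdeal.Quot.lift _ (maxEval q y) fun d hd => by
    refine ClosedIdeal.span_le (J := ClosedIdeal.ker (maxEval q y)) ?_ hd
    rintro _ ⟨f, a, F, rfl⟩
    change maxEval q y _ = 0
    rw [map_sub, maxEval_tmul, maxEval_tmul, C0Algebra.germ_act, smul_smul, mul_comm]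
    exact sub_self _

theorem eval_tmul (q : C(Y, X)) (y : Y) (a : A) (F : C₀(Y, ℂ)) :
    eval q y (tmul q a F) = F y • C0Algebra.germ (q y) a :=
  (ClosedIdeal.Quot.lift_mk _ _ _ _).trans (maxEval_tmul q y a F)

theorem eval_act (q : C(Y, X)) (y : Y) (F : C₀(Y, ℂ)) (t : Pullback A q) :
    eval q y (C0Algebra.act F t) = F y • eval q y t := by
  have hcl : IsClosed {t : Pullback A q | eval q y (C0Algebra.act F t) = F y • eval q y t} :=
    isClosed_eq ((continuous_starHom (eval q y)).comp (C0Algebra.act F).continuous)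
      ((continuous_starHom (eval q y)).const_smul (F y))
  refine hcl.closure_subset_iff.mpr ?_ (dense_span_tmul A q t)
  intro b hb
  induction hb using Submodule.span_induction with
  | mem b hb =>
    obtain ⟨a, G, rfl⟩ := hb
    change eval q y (act q F (tmul q a G)) = F y • eval q y (tmul q a G)
    rw [act_tmul, eval_tmul, eval_tmul, smul_smul]
    rfl
  | zero => simp
  | add b c _ _ hb hc =>
    simp only [Set.mem_ofPred_eq] at hb hc ⊢
    rw [map_add, map_add, map_add, hb, hc, smul_add]
  | smul k b _ hb =>
    simp only [Set.mem_ofPred_eq] at hb ⊢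
    rw [map_smul, map_smul, map_smul, hb, smul_comm]

/-- The canonical map `(q^*A)_y → A_{q(y)}`, `(a ⊗ F)_y ↦ F(y) a_{q(y)}`. -/
def fibreHom (q : C(Y, X)) (y : Y) :
    C0Algebra.Fibre (Pullback A q) y →⋆ₙₐ[ℂ] C0Algebra.Fibre A (q y) :=
  ClosedIdeal.Quot.lift _ (eval q y) fun t ht => by
    refine ClosedIdeal.span_le (J := ClosedIdeal.ker (eval q y)) ?_ ht
    rintro _ ⟨F, t, hF, rfl⟩
    change eval q y _ = 0
    rw [eval_act, hF, zero_smul]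

theorem fibreHom_germ (q : C(Y, X)) (y : Y) (t : Pullback A q) :
    fibreHom q y (C0Algebra.germ y t) = eval q y t :=
  ClosedIdeal.Quot.lift_mk _ _ _ t

theorem germ_tmul_eq_zero (q : C(Y, X)) (y : Y) (a : A) {F : C₀(Y, ℂ)} (hF : F y = 0) :
    C0Algebra.germ y (tmul q a F) = 0 := by
  rw [← norm_le_zero_iff]
  refine le_of_forall_pos_le_add fun ε hε => ?_
  obtain ⟨G, hG⟩ := exists_norm_tmul_lt q a F hε
  have h0 : C0Algebra.germ y (tmul q a (F * G)) = 0 := by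
    rw [← act_tmul]
    exact C0Algebra.germ_act_eq_zero hF _
  have h1 : C0Algebra.germ y (tmul q a F) =
      C0Algebra.germ y (tmul q a F - tmul q a (F * G)) := by
    rw [map_sub, h0, sub_zero]
  rw [h1, zero_add]
  exact (NonUnitalStarAlgHom.norm_apply_le _ _).trans hG.le

theorem germ_tmul_congr (q : C(Y, X)) (y : Y) (a : A) {F G : C₀(Y, ℂ)} (h : F y = G y) :
    C0Algebra.germ y (tmul q a F) = C0Algebra.germ y (tmul q a G) := by
  rw [← sub_eq_zero, ← map_sub, ← tmul_sub]
  exact germ_tmul_eq_zero q y a (by simp [h])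

theorem exists_apply_eq_one [LocallyCompactSpace Y] [T2Space Y] (y : Y) :
    ∃ F : C₀(Y, ℂ), F y = 1 ∧ star F = F := by
  obtain ⟨f, hf1, -, hfc, -⟩ := exists_continuous_one_zero_of_isCompact (isCompact_singleton (x := y))
    isClosed_empty (by simp)
  refine ⟨⟨⟨fun z => (f z : ℂ), by fun_prop⟩, ?_⟩, ?_, ?_⟩
  · have : HasCompactSupport fun z => (f z : ℂ) := hfc.comp_left (g := fun r : ℝ => (r : ℂ)) rfl
    exact this.is_zero_at_infty
  · have : f y = 1 := hf1 rfl
    simp [this]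
  · ext z
    simp

/-- The inverse of the canonical map, `a_{q(y)} ↦ (a ⊗ F)_y` with `F(y) = 1`. -/
theorem exists_fibreInv [LocallyCompactSpace Y] [T2Space Y] (q : C(Y, X)) (y : Y) :
    ∃ σ : C0Algebra.Fibre A (q y) →⋆ₙₐ[ℂ] C0Algebra.Fibre (Pullback A q) y,
      ∀ (a : A) (F : C₀(Y, ℂ)), σ (F y • C0Algebra.germ (q y) a) = C0Algebra.germ y (tmul q a F) := by
  obtain ⟨F, hF, hFs⟩ := exists_apply_eq_one y
  let τ : A →⋆ₙₐ[ℂ] C0Algebra.Fibre (Pullback A q) y :=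
    { toFun := fun a => C0Algebra.germ y (tmul q a F)
      map_smul' := fun c a => by
        rw [tmul, MaxTensor.smul_tmul, map_smul, map_smul]
        rfl
      map_zero' := by rw [tmul, MaxTensor.zero_tmul, map_zero, map_zero]
      map_add' := fun a b => by rw [tmul, MaxTensor.add_tmul, map_add, map_add]; rfl
      map_mul' := fun a b => by
        rw [germ_tmul_congr q y (a * b) (G := F * F) (by simp [hF]), ← map_mul]
        rw [tmul, tmul, tmul, ← map_mul, MaxTensor.tmul_mul_tmul]
      map_star' := fun a => by
        rw [← map_star, tmul, tmul, ← map_star, MaxTensor.star_tmul, hFs] }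
  refine ⟨ClosedIdeal.Quot.lift _ τ fun a ha => ?_, fun a G => ?_⟩
  · refine ClosedIdeal.span_le (J := ClosedIdeal.ker τ) ?_ ha
    rintro _ ⟨f, a, hf, rfl⟩
    change C0Algebra.germ y (tmul q (C0Algebra.act f a) F) = 0
    have : tmul q (C0Algebra.act f a) F = tmul q a (pullMul q f F) := by
      rw [← sub_eq_zero, tmul, tmul, ← map_sub, ClosedIdeal.Quot.mk_eq_zero]
      exact ClosedIdeal.subset_span _ ⟨f, a, F, rfl⟩
    rw [this]
    exact germ_tmul_eq_zero q y a (by simp [pullMul, hf])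
  · rw [map_smul]
    refine (congrArg (G y • ·) (ClosedIdeal.Quot.lift_mk _ τ _ a)).trans ?_
    change G y • τ a = _
    rw [← map_smul]
    change C0Algebra.germ y (tmul q (G y • a) F) = _
    have : tmul q (G y • a) F = tmul q a (G y • F) := by
      rw [tmul, tmul, MaxTensor.smul_tmul, MaxTensor.tmul_smul]
    rw [this]
    exact germ_tmul_congr q y a (by simp [hF])

theorem fibreHom_bijective [LocallyCompactSpace Y] [T2Space Y] (q : C(Y, X)) (y : Y) :
    Function.Bijective (fibreHom (A := A) q y) := by
  obtain ⟨σ, hσ⟩ := exists_fibreInv (A := A) q y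
  constructor
  · refine Function.LeftInverse.injective (g := σ) fun z => ?_
    obtain ⟨t, rfl⟩ := C0Algebra.germ_surjective _ y z
    rw [fibreHom_germ]
    have hcl : IsClosed {t : Pullback A q | σ (eval q y t) = C0Algebra.germ y t} :=
      isClosed_eq ((continuous_starHom σ).comp (continuous_starHom (eval q y)))
        (continuous_starHom (C0Algebra.germ y))
    refine hcl.closure_subset_iff.mpr ?_ (dense_span_tmul A q t)
    intro b hb
    induction hb using Submodule.span_induction with
    | mem b hb =>
      obtain ⟨a, G, rfl⟩ := hb
      rw [Set.mem_ofPred_eq, eval_tmul, hσ]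
    | zero => simp
    | add b c _ _ hb hc =>
      simp only [Set.mem_ofPred_eq] at hb hc ⊢
      rw [map_add, map_add, map_add, hb, hc]
    | smul k b _ hb =>
      simp only [Set.mem_ofPred_eq] at hb ⊢
      rw [map_smul, map_smul, map_smul, hb]
  · intro z
    obtain ⟨a, rfl⟩ := C0Algebra.germ_surjective _ (q y) z
    obtain ⟨F, hF, -⟩ := exists_apply_eq_one y
    exact ⟨C0Algebra.germ y (tmul q a F), by
      rw [fibreHom_germ, eval_tmul, hF, one_smul]⟩

/-- The canonical identification `(q^*A)_y = A_{q(y)}`, `(a ⊗ F)_y ↦ F(y) a_{q(y)}`. -/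
def fibreIso [LocallyCompactSpace Y] [T2Space Y] (q : C(Y, X)) (y : Y) :
    C0Algebra.Fibre (Pullback A q) y ≃⋆ₐ[ℂ] C0Algebra.Fibre A (q y) :=
  StarAlgEquiv.ofBijective (fibreHom q y) (fibreHom_bijective q y)

end Pullback
end Pullback

/-! ### Isomorphisms of `C₀(Y)`-algebras and the induced maps of the fibres -/

/-- A `C₀(Y)`-isomorphism: a `*`-isomorphism that is a `C₀(Y)`-module map. -/
structure C0Iso (Y A B : Type*) [TopologicalSpace Y] [NonUnitalCStarAlgebra A] [C0Algebra Y A]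
    [NonUnitalCStarAlgebra B] [C0Algebra Y B] extends A ≃⋆ₐ[ℂ] B where
  map_act' : ∀ (F : C₀(Y, ℂ)) (a : A),
    toFun (C0Algebra.act F a) = C0Algebra.act F (toFun a)

namespace C0Iso

variable {Y A B : Type*} [TopologicalSpace Y] [NonUnitalCStarAlgebra A] [C0Algebra Y A]
  [NonUnitalCStarAlgebra B] [C0Algebra Y B]

theorem map_act (e : C0Iso Y A B) (F : C₀(Y, ℂ)) (a : A) :
    e.toStarAlgEquiv (C0Algebra.act F a) = C0Algebra.act F (e.toStarAlgEquiv a) := e.map_act' F a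

/-- The inverse of a `C₀(Y)`-isomorphism. -/
def symm (e : C0Iso Y A B) : C0Iso Y B A where
  toStarAlgEquiv := e.toStarAlgEquiv.symm
  map_act' F b := by
    change e.toStarAlgEquiv.symm (C0Algebra.act F b) = C0Algebra.act F (e.toStarAlgEquiv.symm b)
    obtain ⟨a, rfl⟩ : ∃ a, e.toStarAlgEquiv a = b :=
      ⟨_, e.toStarAlgEquiv.apply_symm_apply b⟩
    rw [← e.map_act, StarAlgEquiv.symm_apply_apply, StarAlgEquiv.symm_apply_apply]

/-- The `*`-homomorphism `A_y → B_y`, `a_y ↦ (e a)_y`. -/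
def fibreHom (e : C0Iso Y A B) (y : Y) : C0Algebra.Fibre A y →⋆ₙₐ[ℂ] C0Algebra.Fibre B y :=
  ClosedIdeal.Quot.lift _
    ((C0Algebra.germ y).comp (e.toStarAlgEquiv : A →⋆ₙₐ[ℂ] B)) fun a ha => by
      refine ClosedIdeal.span_le (J := ClosedIdeal.ker
        ((C0Algebra.germ y).comp (e.toStarAlgEquiv : A →⋆ₙₐ[ℂ] B))) ?_ ha
      rintro _ ⟨F, a, hF, rfl⟩
      change C0Algebra.germ y (e.toStarAlgEquiv (C0Algebra.act F a)) = 0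
      rw [e.map_act, C0Algebra.germ_act_eq_zero hF]

theorem fibreHom_germ (e : C0Iso Y A B) (y : Y) (a : A) :
    e.fibreHom y (C0Algebra.germ y a) = C0Algebra.germ y (e.toStarAlgEquiv a) :=
  ClosedIdeal.Quot.lift_mk _ _ _ a

theorem fibreHom_bijective (e : C0Iso Y A B) (y : Y) : Function.Bijective (e.fibreHom y) := by
  refine Function.bijective_iff_has_inverse.mpr ⟨e.symm.fibreHom y, fun z => ?_, fun z => ?_⟩
  · obtain ⟨a, rfl⟩ := C0Algebra.germ_surjective _ y z
    rw [fibreHom_germ, fibreHom_germ]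
    exact congrArg _ (e.toStarAlgEquiv.symm_apply_apply a)
  · obtain ⟨b, rfl⟩ := C0Algebra.germ_surjective _ y z
    rw [fibreHom_germ, fibreHom_germ]
    exact congrArg _ (e.toStarAlgEquiv.apply_symm_apply b)

/-- The induced isomorphism `A_y → B_y`, `a_y ↦ (e a)_y`, of the fibres. -/
def fibre (e : C0Iso Y A B) (y : Y) : C0Algebra.Fibre A y ≃⋆ₐ[ℂ] C0Algebra.Fibre B y :=
  StarAlgEquiv.ofBijective (e.fibreHom y) (e.fibreHom_bijective y)

end C0Iso

/-! ### Topological groupoids -/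

open CategoryTheory

/-- The set `Γ` of all arrows of a groupoid with unit space `X`. -/
structure Arrows (X : Type*) [Groupoid X] where
  /-- the source `s(γ)` -/
  src : X
  /-- the range `r(γ)` -/
  tgt : X
  /-- the arrow itself -/
  hom : src ⟶ tgt

namespace Arrows

variable {X : Type*} [Groupoid X]

/-- The unit at `x`. -/
def unit (x : X) : Arrows X := ⟨x, x, 𝟙 x⟩

/-- The inverse `γ⁻¹`. -/
def inverse (γ : Arrows X) : Arrows X := ⟨γ.tgt, γ.src, Groupoid.inv γ.hom⟩

/-- The product `γ γ'`, defined when `s(γ) = r(γ')`. -/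
def mul (γ γ' : Arrows X) (h : γ.src = γ'.tgt) : Arrows X :=
  ⟨γ'.src, γ.tgt, γ'.hom ≫ eqToHom h.symm ≫ γ.hom⟩

end Arrows

/-- A topological groupoid with unit space `X`: its arrows and its units carry topologies for which
source, range, units, inversion and multiplication are continuous. (The unit map is then a
homeomorphism onto its image, since `s` is a continuous left inverse of it.) -/
class IsTopologicalGroupoid (X : Type*) [Groupoid X] [TopologicalSpace X]
    [TopologicalSpace (Arrows X)] : Prop where
  continuous_src : Continuous (Arrows.src : Arrows X → X)
  continuous_tgt : Continuous (Arrows.tgt : Arrows X → X)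
  continuous_unit : Continuous (Arrows.unit : X → Arrows X)
  continuous_inverse : Continuous (Arrows.inverse : Arrows X → Arrows X)
  continuous_mul : Continuous fun z : {z : Arrows X × Arrows X // z.1.src = z.2.tgt} =>
    Arrows.mul z.1.1 z.1.2 z.2

section Gamma

variable (X : Type*) [Groupoid X] [TopologicalSpace X] [TopologicalSpace (Arrows X)]
  [IsTopologicalGroupoid X]

/-- The source map `s : Γ → X`. -/
def srcMap : C(Arrows X, X) := ⟨Arrows.src, IsTopologicalGroupoid.continuous_src⟩

/-- The range map `r : Γ → X`. -/
def tgtMap : C(Arrows X, X) := ⟨Arrows.tgt, IsTopologicalGroupoid.continuous_tgt⟩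

section GammaAlgebra

variable (A : Type*) [NonUnitalCStarAlgebra A] [C0Algebra X A]

variable {X A} in
/-- The isomorphism `α_γ : A_{s(γ)} = (s^*A)_γ → (r^*A)_γ = A_{r(γ)}` induced by a
`C₀(Γ)`-isomorphism `α : s^*A → r^*A`. -/
def inducedIso [T2Space (Arrows X)] [LocallyCompactSpace (Arrows X)]
    (α : C0Iso (Arrows X) (Pullback A (srcMap X)) (Pullback A (tgtMap X))) (γ : Arrows X) :
    C0Algebra.Fibre A γ.src ≃⋆ₐ[ℂ] C0Algebra.Fibre A γ.tgt :=
  ((Pullback.fibreIso (A := A) (srcMap X) γ).symm.trans (α.fibre γ)).trans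
    (Pullback.fibreIso (A := A) (tgtMap X) γ)

/-- A `Γ`-algebra structure on the `C₀(X)`-algebra `A`: a `C₀(Γ)`-isomorphism `α : s^*A → r^*A`
with `α_{γγ'} = α_γ α_{γ'}` and `α_{γ⁻¹} = α_γ⁻¹`. -/
structure GammaAlgebra [T2Space (Arrows X)] [LocallyCompactSpace (Arrows X)] where
  /-- the isomorphism `α : s^*A → r^*A` -/
  iso : C0Iso (Arrows X) (Pullback A (srcMap X)) (Pullback A (tgtMap X))
  map_mul : ∀ {x y z : X} (g : y ⟶ z) (f : x ⟶ y),
    inducedIso iso ⟨x, z, f ≫ g⟩ = (inducedIso iso ⟨x, y, f⟩).trans (inducedIso iso ⟨y, z, g⟩)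
  map_inv : ∀ {x y : X} (f : x ⟶ y),
    inducedIso iso ⟨y, x, Groupoid.inv f⟩ = (inducedIso iso ⟨x, y, f⟩).symm

end GammaAlgebra

/-- The structure of a continuous `Γ`-space of C⋆-algebras on the space `M = ⊔ₓ E x`, fibred over
`X` by `p : M → X`: the projection `p` is continuous, open and onto, and `Γ` acts on `M` by
`*`-isomorphisms `α_γ : M_{s(γ)} → M_{r(γ)}` so that `(γ, z) ↦ α_γ(z)` is continuous on
`Γ ×ₛ M = {(γ, z) | s(γ) = p(z)}`. -/
structure ContinuousGammaSpace (E : X → Type*) [∀ x, NonUnitalCStarAlgebra (E x)]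
    [TopologicalSpace (BundleTotal E)] where
  continuous_proj : Continuous (BundleTotal.pt : BundleTotal E → X)
  isOpenMap_proj : IsOpenMap (BundleTotal.pt : BundleTotal E → X)
  surjective_proj : Function.Surjective (BundleTotal.pt : BundleTotal E → X)
  /-- the isomorphism `α_γ` -/
  iso : ∀ γ : Arrows X, E γ.src ≃⋆ₐ[ℂ] E γ.tgt
  map_unit : ∀ (x : X) (z : E x), iso ⟨x, x, 𝟙 x⟩ z = z
  map_mul : ∀ {x y z : X} (g : y ⟶ z) (f : x ⟶ y) (w : E x),
    iso ⟨x, z, f ≫ g⟩ w = iso ⟨y, z, g⟩ (iso ⟨x, y, f⟩ w)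
  continuous_act : Continuous fun w : {w : Arrows X × BundleTotal E // w.1.src = w.2.pt} =>
    (⟨w.1.1.tgt, iso w.1.1 (w.2.symm ▸ w.1.2.val)⟩ : BundleTotal E)

end Gamma

end

/-! The proof identifies a `C₀(Y)`-algebra with an algebra of sections of its bundle of fibres, and
reads both structures of the theorem as one condition on a family of fibre isomorphisms.

Let `Y` be locally compact Hausdorff and `B` a `C₀(Y)`-algebra. Two facts carry everything. First,
the norm of `b` is controlled by the norms of its germs
(`C0Algebra.norm_le_of_forall_norm_germ_le`), so an element is determined by its germs. Instead of
representation theory this uses a partition of unity `∑ kᵢ² ≤ 1`: each `kᵢ (b⋆b) kᵢ` is at most a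
constant times `kᵢ²` in the multiplier algebra, and the inequalities add up. Secondly, a section of
the fibres that vanishes at infinity and is locally approximated by germs of elements is itself
given by an element (`C0Algebra.exists_germ_eq`): patching with partitions of unity gives uniform
approximations, and by the first fact these form a Cauchy sequence in `B`.

Applied to `q^*A` with fibres `A_{q(y)}`, this describes `q^*A` as the sections vanishing at
infinity that are locally close to sections `y ↦ a_{q(y)}` with `a ∈ A`. Hence a `C₀(Γ)`-isomorphism
`s^*A → r^*A` amounts to a family of isomorphisms `A_{s(γ)} → A_{r(γ)}` that respects this local
closeness, which is the condition `ContinuousFamily`. Since `*`-isomorphisms are isometric, no bound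
has to be imposed, and the inverse family satisfies the same condition.

On the side of the bundle, convergence to `a_x` in `A^♯` means convergence of base points together
with `‖z - a_{p(z)}‖ → 0` (`Sharp.tendsto_nhds_germ`). Continuity of the action on `Γ ×ₛ A^♯`
therefore is again `ContinuousFamily` (`continuous_act_iff`). The projection of `A^♯` is always
continuous, open and onto. The groupoid laws are fibrewise; only the laws for units and inverses
have to be converted into each other, by cancellation. -/

noncomputable section

/-! ### Compactly supported functions and partitions of unity -/

section CompactSupport

variable {Y : Type*} [TopologicalSpace Y]

/-- A real function of compact support, as an element of `C₀(Y)`. -/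
def compactC0 (g : C(Y, ℝ)) (hg : HasCompactSupport g) : C₀(Y, ℂ) where
  toFun z := (g z : ℂ)
  continuous_toFun := by fun_prop
  zero_at_infty' :=
    (hg.comp_left (g := fun r : ℝ => (r : ℂ)) rfl).is_zero_at_infty

@[simp] theorem compactC0_apply (g : C(Y, ℝ)) (hg : HasCompactSupport g) (z : Y) :
    compactC0 g hg z = (g z : ℂ) := rfl

theorem star_compactC0 (g : C(Y, ℝ)) (hg : HasCompactSupport g) :
    star (compactC0 g hg) = compactC0 g hg := by
  ext z
  simp

theorem norm_c0_le {f : C₀(Y, ℂ)} {C : ℝ} (hC : 0 ≤ C) (h : ∀ z, ‖f z‖ ≤ C) : ‖f‖ ≤ C := by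
  rw [← ZeroAtInftyContinuousMap.norm_toBCF_eq_norm]
  exact (BoundedContinuousFunction.norm_le hC).mpr h

/-- A finite partition of unity over a compact set, subordinate to a system of neighbourhoods. -/
theorem exists_finite_partition [T2Space Y] [LocallyCompactSpace Y] {K : Set Y} (hK : IsCompact K)
    {U : Y → Set Y} (hU : ∀ y, U y ∈ 𝓝 y) :
    ∃ (t : Finset Y) (g : t → C(Y, ℝ)), (∀ i, HasCompactSupport (g i)) ∧
      (∀ i, tsupport (g i) ⊆ interior (U i)) ∧ (∀ i z, 0 ≤ g i z) ∧
      (∀ z, ∑ i, g i z ≤ 1) ∧ ∀ z ∈ K, ∑ i, g i z = 1 := by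
  obtain ⟨t, -, ht⟩ := hK.elim_nhds_subcover (fun y => interior (U y))
    fun y _ => interior_mem_nhds.mpr (hU y)
  obtain ⟨f, hf, hfc⟩ := PartitionOfUnity.exists_isSubordinate_of_locallyFinite_t2space hK
    (fun i : t => interior (U i)) (fun _ => isOpen_interior) (locallyFinite_of_finite _)
    (ht.trans fun z hz => by
      obtain ⟨y, hy, hz⟩ := Set.mem_iUnion₂.mp hz
      exact Set.mem_iUnion.mpr ⟨⟨y, hy⟩, hz⟩)
  refine ⟨t, fun i => f i, hfc, hf, fun i z => f.nonneg i z, fun z => ?_, fun z hz => ?_⟩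
  · rw [← finsum_eq_sum_of_fintype]
    exact f.sum_le_one z
  · rw [← finsum_eq_sum_of_fintype]
    exact f.sum_eq_one hz

end CompactSupport

/-! ### The module structure of a `C₀(X)`-algebra -/

namespace C0Algebra

section Module

variable {X A : Type*} [TopologicalSpace X] [NonUnitalCStarAlgebra A] [C0Algebra X A]

theorem act_mul_apply (f : C₀(X, ℂ)) (a b : A) : act f (a * b) = act f a * b :=
  fst_mul_apply _ a b

/-- This is where centrality of `θ f` enters: it commutes with the multiplier "left multiplication
by `a`". -/
theorem act_mul_apply' (f : C₀(X, ℂ)) (a b : A) : act f (a * b) = a * act f b := by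
  have h := congrArg (fun m : 𝓜(ℂ, A) => m.fst b) (central (X := X) f (a : 𝓜(ℂ, A)))
  simpa [act] using! h

/-- A central multiplier acts in the same way from both sides. Since the involution of the
multiplier algebra interchanges the two sides, this is what makes `star_act` hold. -/
theorem snd_θ (f : C₀(X, ℂ)) (a : A) : (θ f : 𝓜(ℂ, A)).snd a = act f a :=
  eq_of_forall_mul_right fun z => by
    rw [(θ f : 𝓜(ℂ, A)).central, ← act_mul_apply, act_mul_apply']
    rfl

theorem star_act (f : C₀(X, ℂ)) (a : A) : star (act f a) = act (star f) (star a) := by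
  have : act (star f) (star a) = star ((θ f : 𝓜(ℂ, A)).snd (star (star a))) := by
    rw [← DoubleCentralizer.star_fst, act, map_star θ f]
  rw [this, star_star, snd_θ]

theorem norm_act_le (f : C₀(X, ℂ)) (a : A) : ‖act f a‖ ≤ ‖f‖ * ‖a‖ := by
  refine ((act f).le_opNorm a).trans ?_
  gcongr
  rw [act, DoubleCentralizer.norm_fst]
  exact NonUnitalStarAlgHom.norm_apply_le _ _

theorem act_sum {ι : Type*} (s : Finset ι) (f : ι → C₀(X, ℂ)) (a : A) :
    act (∑ i ∈ s, f i) a = ∑ i ∈ s, act (f i) a := by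
  classical
  induction s using Finset.induction_on with
  | empty => simp [act]
  | insert i s hi ih => rw [Finset.sum_insert hi, Finset.sum_insert hi, act_add, ih]

theorem norm_germ_le (x : X) (a : A) : ‖germ x a‖ ≤ ‖a‖ := NonUnitalStarAlgHom.norm_apply_le _ a

/-- Induction over a `C₀(X)`-algebra: from the elements `f a` to all elements. -/
theorem induct {P : A → Prop} (hact : ∀ (f : C₀(X, ℂ)) a, P (act f a)) (hzero : P 0)
    (hadd : ∀ a b, P a → P b → P (a + b)) (hsmul : ∀ (c : ℂ) a, P a → P (c • a))
    (hcl : IsClosed {a | P a}) (a : A) : P a := by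
  refine hcl.closure_subset_iff.mpr ?_ (nondegenerate (X := X) (A := A) a)
  intro b hb
  induction hb using Submodule.span_induction with
  | mem b hb => obtain ⟨f, c, rfl⟩ := hb; exact hact f c
  | zero => exact hzero
  | add b c _ _ hb hc => exact hadd b c hb hc
  | smul k b _ hb => exact hsmul k b hb

/-- An element whose germ vanishes at `x₀` has small germs near `x₀`. -/
theorem tendsto_norm_germ_zero {x₀ : X} {a : A} (ha : germ x₀ a = 0) :
    Filter.Tendsto (fun x => ‖germ x a‖) (𝓝 x₀) (𝓝 0) := by
  -- The elements with the desired property form a closed ideal, so only the generators `f b` with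
  -- `f x₀ = 0` of `I_{x₀} A` have to be checked; for these the germ at `x` has norm at most `|f x|
  -- ‖b‖`.
  let N : ClosedIdeal A :=
    { carrier := {a | Filter.Tendsto (fun x => ‖germ x a‖) (𝓝 x₀) (𝓝 0)}
      add_mem' := fun {a b} ha hb => by
        refine squeeze_zero (fun _ => norm_nonneg _) (fun x => ?_) (by simpa using ha.add hb)
        rw [map_add]
        exact norm_add_le _ _
      zero_mem' := by simp
      smul_mem' := fun c a ha => by
        refine squeeze_zero (fun _ => norm_nonneg _) (fun x => ?_)
          (by simpa using ha.const_mul ‖c‖)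
        rw [map_smul, norm_smul]
      mul_left_mem := fun a b hb => by
        refine squeeze_zero (fun _ => norm_nonneg _) (fun x => ?_)
          (by simpa using hb.const_mul ‖a‖)
        rw [map_mul]
        refine (norm_mul_le _ _).trans ?_
        gcongr
        exact norm_germ_le x a
      mul_right_mem := fun {a} b ha => by
        refine squeeze_zero (fun _ => norm_nonneg _) (fun x => ?_)
          (by simpa using ha.mul_const ‖b‖)
        rw [map_mul]
        refine (norm_mul_le _ _).trans ?_
        gcongr
        exact norm_germ_le x b
      star_mem := fun {a} ha => by
        refine squeeze_zero (fun _ => norm_nonneg _) (fun x => ?_) ha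
        rw [map_star, norm_star]
      isClosed := by
        refine isClosed_of_closure_subset fun a ha => ?_
        refine Metric.tendsto_nhds.mpr fun ε hε => ?_
        obtain ⟨b, hb, hab⟩ := Metric.mem_closure_iff.mp ha (ε / 2) (half_pos hε)
        filter_upwards [Metric.tendsto_nhds.mp hb (ε / 2) (half_pos hε)] with x hx
        rw [dist_zero_right, norm_norm] at hx ⊢
        calc ‖germ x a‖ = ‖germ x (a - b) + germ x b‖ := by rw [← map_add, sub_add_cancel]
          _ ≤ ‖a - b‖ + ‖germ x b‖ := (norm_add_le _ _).trans (by gcongr; exact norm_germ_le _ _)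
          _ < ε / 2 + ε / 2 := by rw [← dist_eq_norm]; exact add_lt_add hab hx
          _ = ε := add_halves ε }
  refine ClosedIdeal.span_le (J := N) ?_ ((ClosedIdeal.Quot.mk_eq_zero _).mp ha)
  rintro _ ⟨f, b, hf, rfl⟩
  have hc : Filter.Tendsto (fun x => ‖f x‖ * ‖b‖) (𝓝 x₀) (𝓝 0) := by
    have : Continuous fun x => ‖f x‖ * ‖b‖ := by fun_prop
    simpa [hf] using this.tendsto x₀
  refine squeeze_zero (fun _ => norm_nonneg _) (fun x => ?_) hc
  rw [germ_act, norm_smul]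
  gcongr
  exact norm_germ_le x b

/-- The norms of the germs of an element vanish at infinity. -/
theorem tendsto_norm_germ_cocompact (a : A) :
    Filter.Tendsto (fun x : X => ‖germ x a‖) (Filter.cocompact X) (𝓝 0) := by
  refine induct (X := X) (P := fun a => Filter.Tendsto (fun x : X => ‖germ x a‖)
    (Filter.cocompact X) (𝓝 0)) (fun f a => ?_) (by simpa using tendsto_const_nhds) (fun a b ha hb => ?_)
    (fun c a ha => ?_) ?_ a
  · have h : Filter.Tendsto (fun x => ‖f x‖ * ‖a‖) (Filter.cocompact X) (𝓝 0) := by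
      simpa using (f.zero_at_infty'.norm).mul_const ‖a‖
    refine squeeze_zero (fun _ => norm_nonneg _) (fun x => ?_) h
    rw [germ_act, norm_smul]
    gcongr
    exact norm_germ_le x a
  · refine squeeze_zero (fun _ => norm_nonneg _) (fun x => ?_) (by simpa using ha.add hb)
    rw [map_add]
    exact norm_add_le _ _
  · refine squeeze_zero (fun _ => norm_nonneg _) (fun x => ?_)
      (by simpa using ha.const_mul ‖c‖)
    rw [map_smul, norm_smul]
  · refine isClosed_of_closure_subset fun a ha => ?_
    refine Metric.tendsto_nhds.mpr fun ε hε => ?_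
    obtain ⟨b, hb, hab⟩ := Metric.mem_closure_iff.mp ha (ε / 2) (half_pos hε)
    filter_upwards [Metric.tendsto_nhds.mp hb (ε / 2) (half_pos hε)] with x hx
    rw [dist_zero_right, norm_norm] at hx ⊢
    calc ‖germ x a‖ = ‖germ x (a - b) + germ x b‖ := by rw [← map_add, sub_add_cancel]
      _ ≤ ‖a - b‖ + ‖germ x b‖ := (norm_add_le _ _).trans (by gcongr; exact norm_germ_le _ _)
      _ < ε / 2 + ε / 2 := by rw [← dist_eq_norm]; exact add_lt_add hab hx
      _ = ε := add_halves ε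

/-- Functions that are `1` on a large compact set act almost as the identity. -/
theorem exists_compact_norm_sub_act_le (a : A) {ε : ℝ} (hε : 0 < ε) :
    ∃ K : Set X, IsCompact K ∧ ∀ g : C₀(X, ℂ), (∀ z ∈ K, g z = 1) → (∀ z, ‖g z‖ ≤ 1) →
      ‖a - act g a‖ ≤ ε := by
  refine induct (X := X) (P := fun a => ∀ ε > 0, ∃ K : Set X, IsCompact K ∧ ∀ g : C₀(X, ℂ),
    (∀ z ∈ K, g z = 1) → (∀ z, ‖g z‖ ≤ 1) → ‖a - act g a‖ ≤ ε)
    (fun f a ε hε => ?_) (fun ε hε => ⟨∅, isCompact_empty, fun g _ _ => by simpa using hε.le⟩)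
    (fun a b ha hb ε hε => ?_) (fun c a ha ε hε => ?_) ?_ a ε hε
  -- The factor `2` pays for `|f - g f| ≤ 2 |f|` off `K`, where `g` is only known to be bounded by
  -- `1`. The summand `1` in `‖a‖ + 1` avoids division by zero.
  · obtain ⟨K, hK, hKf⟩ := Filter.mem_cocompact.mp
      (Metric.tendsto_nhds.mp f.zero_at_infty' (ε / (2 * (‖a‖ + 1))) (by positivity))
    refine ⟨K, hK, fun g hg hg1 => ?_⟩
    rw [← act_mul, ← act_sub]
    have h : ‖f - g * f‖ ≤ ε / (‖a‖ + 1) := norm_c0_le (by positivity) fun z => by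
      change ‖f z - g z * f z‖ ≤ _
      by_cases hz : z ∈ K
      · rw [hg z hz, one_mul, sub_self, norm_zero]; positivity
      · have h1 := hKf hz
        rw [Set.mem_ofPred_eq, dist_zero_right] at h1
        calc ‖f z - g z * f z‖ ≤ ‖f z‖ + ‖g z‖ * ‖f z‖ := by
              rw [← norm_mul]; exact norm_sub_le _ _
          _ ≤ ‖f z‖ + 1 * ‖f z‖ := by gcongr; exact hg1 z
          _ = 2 * ‖f z‖ := by ring
          _ ≤ 2 * (ε / (2 * (‖a‖ + 1))) := by gcongr; exact h1.le
          _ = _ := by field_simp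
    calc _ ≤ ‖f - g * f‖ * ‖a‖ := norm_act_le _ _
      _ ≤ ε / (‖a‖ + 1) * (‖a‖ + 1) := by gcongr; linarith
      _ = ε := by field_simp
  · obtain ⟨K, hK, hKa⟩ := ha (ε / 2) (half_pos hε)
    obtain ⟨L, hL, hLb⟩ := hb (ε / 2) (half_pos hε)
    refine ⟨K ∪ L, hK.union hL, fun g hg hg1 => ?_⟩
    rw [map_add, add_sub_add_comm]
    refine (norm_add_le _ _).trans ((add_le_add (hKa g (fun z hz => hg z (.inl hz)) hg1)
      (hLb g (fun z hz => hg z (.inr hz)) hg1)).trans (add_halves ε).le)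
  · obtain ⟨K, hK, hKa⟩ := ha (ε / (‖c‖ + 1)) (by positivity)
    refine ⟨K, hK, fun g hg hg1 => ?_⟩
    rw [map_smul, ← smul_sub, norm_smul]
    calc _ ≤ (‖c‖ + 1) * (ε / (‖c‖ + 1)) := by
          gcongr
          · linarith
          · exact hKa g hg hg1
      _ = ε := by field_simp
  · refine isClosed_of_closure_subset fun a ha ε hε => ?_
    -- Three errors occur: `a - b`, its compression by `g`, which is no larger because `‖g‖ ≤ 1`,
    -- and the error for `b`.
    obtain ⟨b, hb, hab⟩ := Metric.mem_closure_iff.mp ha (ε / 3) (by positivity)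
    obtain ⟨K, hK, hKb⟩ := hb (ε / 3) (by positivity)
    refine ⟨K, hK, fun g hg hg1 => ?_⟩
    rw [dist_eq_norm] at hab
    have h1 : ‖act g (a - b)‖ ≤ ‖a - b‖ := (norm_act_le _ _).trans
      (mul_le_of_le_one_left (norm_nonneg _) (norm_c0_le zero_le_one hg1))
    calc ‖a - act g a‖ = ‖(a - b) + (b - act g b) - act g (a - b)‖ := by
          rw [map_sub]; congr 1; abel
      _ ≤ ‖a - b‖ + ‖b - act g b‖ + ‖act g (a - b)‖ :=
          (norm_sub_le _ _).trans (by gcongr; exact norm_add_le _ _)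
      _ ≤ ε / 3 + ε / 3 + ε / 3 := by
          gcongr
          · exact hKb g hg hg1
          · exact h1.trans hab.le
      _ = ε := by ring

/-- Functions supported near `x₀` compress an element of the ideal `I_{x₀} A` to a small one. -/
theorem exists_nhds_norm_act_le_of_germ_eq_zero {x₀ : X} {a : A} (ha : germ x₀ a = 0) {ε : ℝ}
    (hε : 0 < ε) : ∃ U ∈ 𝓝 x₀, ∀ g : C₀(X, ℂ), (∀ z ∉ U, g z = 0) → (∀ z, ‖g z‖ ≤ 1) →
      ‖act g a‖ ≤ ε := by
  -- Again the property defines a closed ideal, and only the generators of `I_{x₀} A` need an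
  -- argument.
  let N : ClosedIdeal A :=
    { carrier := {a | ∀ ε > 0, ∃ U ∈ 𝓝 x₀, ∀ g : C₀(X, ℂ), (∀ z ∉ U, g z = 0) →
        (∀ z, ‖g z‖ ≤ 1) → ‖act g a‖ ≤ ε}
      add_mem' := fun {a b} ha hb ε hε => by
        obtain ⟨U, hU, hUa⟩ := ha (ε / 2) (half_pos hε)
        obtain ⟨V, hV, hVb⟩ := hb (ε / 2) (half_pos hε)
        refine ⟨U ∩ V, Filter.inter_mem hU hV, fun g hg hg1 => ?_⟩
        rw [map_add]
        exact (norm_add_le _ _).trans ((add_le_add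
          (hUa g (fun z hz => hg z fun h => hz h.1) hg1)
          (hVb g (fun z hz => hg z fun h => hz h.2) hg1)).trans (add_halves ε).le)
      zero_mem' := fun ε hε => ⟨Set.univ, Filter.univ_mem, fun g _ _ => by simpa using hε.le⟩
      smul_mem' := fun c a ha ε hε => by
        obtain ⟨U, hU, hUa⟩ := ha (ε / (‖c‖ + 1)) (by positivity)
        refine ⟨U, hU, fun g hg hg1 => ?_⟩
        rw [map_smul, norm_smul]
        calc _ ≤ (‖c‖ + 1) * (ε / (‖c‖ + 1)) := by
              gcongr
              · linarith
              · exact hUa g hg hg1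
          _ = ε := by field_simp
      mul_left_mem := fun c a ha ε hε => by
        obtain ⟨U, hU, hUa⟩ := ha (ε / (‖c‖ + 1)) (by positivity)
        refine ⟨U, hU, fun g hg hg1 => ?_⟩
        rw [act_mul_apply']
        calc _ ≤ ‖c‖ * ‖act g a‖ := norm_mul_le _ _
          _ ≤ (‖c‖ + 1) * (ε / (‖c‖ + 1)) := by
              gcongr
              · linarith
              · exact hUa g hg hg1
          _ = ε := by field_simp
      mul_right_mem := fun {a} c ha ε hε => by
        obtain ⟨U, hU, hUa⟩ := ha (ε / (‖c‖ + 1)) (by positivity)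
        refine ⟨U, hU, fun g hg hg1 => ?_⟩
        rw [act_mul_apply]
        calc _ ≤ ‖act g a‖ * ‖c‖ := norm_mul_le _ _
          _ ≤ (ε / (‖c‖ + 1)) * (‖c‖ + 1) := by
              gcongr
              · exact hUa g hg hg1
              · linarith
          _ = ε := by field_simp
      star_mem := fun {a} ha ε hε => by
        obtain ⟨U, hU, hUa⟩ := ha ε hε
        refine ⟨U, hU, fun g hg hg1 => ?_⟩
        rw [← norm_star, star_act, star_star]
        -- The bound for `a` is used with `star g`, which has the same zeros and the same absolute
        -- value as `g`.
        exact hUa _ (fun z hz => by simp [hg z hz]) fun z => by simpa using hg1 z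
      isClosed := by
        refine isClosed_of_closure_subset fun a ha ε hε => ?_
        obtain ⟨b, hb, hab⟩ := Metric.mem_closure_iff.mp ha (ε / 2) (half_pos hε)
        obtain ⟨U, hU, hUb⟩ := hb (ε / 2) (half_pos hε)
        refine ⟨U, hU, fun g hg hg1 => ?_⟩
        rw [dist_eq_norm] at hab
        have h1 : ‖act g (a - b)‖ ≤ ‖a - b‖ := (norm_act_le _ _).trans
          (mul_le_of_le_one_left (norm_nonneg _) (norm_c0_le zero_le_one hg1))
        calc ‖act g a‖ = ‖act g (a - b) + act g b‖ := by rw [← map_add, sub_add_cancel]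
          _ ≤ ε / 2 + ε / 2 := (norm_add_le _ _).trans
              (add_le_add (h1.trans hab.le) (hUb g hg hg1))
          _ = ε := add_halves ε }
  refine ClosedIdeal.span_le (J := N) ?_ ((ClosedIdeal.Quot.mk_eq_zero _).mp ha) ε hε
  rintro _ ⟨f, b, hf, rfl⟩ ε hε
  have hc : Filter.Tendsto f (𝓝 x₀) (𝓝 0) := by
    simpa [hf] using (map_continuous f).tendsto x₀
  -- The neighbourhood is the set where `|f| < ε / (‖b‖ + 1)`. Off it `g` vanishes, so `g f` is
  -- uniformly small.
  refine ⟨_, Metric.tendsto_nhds.mp hc (ε / (‖b‖ + 1)) (by positivity), fun g hg hg1 => ?_⟩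
  rw [← act_mul]
  have h : ‖g * f‖ ≤ ε / (‖b‖ + 1) := norm_c0_le (by positivity) fun z => by
    change ‖g z * f z‖ ≤ _
    rw [norm_mul]
    by_cases hz : dist (f z) 0 < ε / (‖b‖ + 1)
    · rw [dist_zero_right] at hz
      exact (mul_le_of_le_one_left (norm_nonneg _) (hg1 z)).trans hz.le
    · rw [hg z hz, norm_zero, zero_mul]; positivity
  calc _ ≤ ‖g * f‖ * ‖b‖ := norm_act_le _ _
    _ ≤ ε / (‖b‖ + 1) * (‖b‖ + 1) := by gcongr; linarith
    _ = ε := by field_simp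

/-- Functions supported near `x₀` compress `a` to an element of norm at most about `‖a_{x₀}‖`. -/
theorem exists_nhds_norm_act_le (x₀ : X) (a : A) {ε : ℝ} (hε : 0 < ε) :
    ∃ U ∈ 𝓝 x₀, ∀ g : C₀(X, ℂ), (∀ z ∉ U, g z = 0) → (∀ z, ‖g z‖ ≤ 1) →
      ‖act g a‖ ≤ ‖germ x₀ a‖ + ε := by
  -- The norm of `a_{x₀}` is a quotient norm: `a` is replaced by a lift `c` of nearly minimal norm,
  -- and the difference `a - c` lies in the ideal of `x₀`.
  obtain ⟨c, hc, hcn⟩ := ClosedIdeal.Quot.exists_rep _ (germ x₀ a) (half_pos hε)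
  have h0 : germ x₀ (a - c) = 0 := by rw [map_sub, sub_eq_zero]; exact hc.symm
  obtain ⟨U, hU, hUg⟩ := exists_nhds_norm_act_le_of_germ_eq_zero h0 (half_pos hε)
  refine ⟨U, hU, fun g hg hg1 => ?_⟩
  have h1 : ‖act g c‖ ≤ ‖c‖ := (norm_act_le _ _).trans
    (mul_le_of_le_one_left (norm_nonneg _) (norm_c0_le zero_le_one hg1))
  calc ‖act g a‖ = ‖act g c + act g (a - c)‖ := by rw [← map_add, add_sub_cancel]
    _ ≤ (‖germ x₀ a‖ + ε / 2) + ε / 2 := (norm_add_le _ _).trans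
        (add_le_add (h1.trans hcn.le) (hUg g hg hg1))
    _ = _ := by ring

end Module

end C0Algebra

/-! ### A `C₀(Y)`-algebra as an algebra of sections of its fibres -/

namespace C0Algebra

section Norm

attribute [local instance] CStarAlgebra.spectralOrder CStarAlgebra.spectralOrderedRing

variable {Y B : Type*} [TopologicalSpace Y] [NonUnitalCStarAlgebra B] [C0Algebra Y B]

/-- The inclusion of a C⋆-algebra into its multiplier algebra. -/
def toMultiplier (B : Type*) [NonUnitalCStarAlgebra B] : B →⋆ₙₐ[ℂ] 𝓜(ℂ, B) :=
  DoubleCentralizer.coeHom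

/-- An element is determined by left multiplication by it. The inclusion is therefore isometric, and
norms in `B` can be computed in the multiplier algebra, which is unital and contains `θ(f)` as well,
so that order comparisons between `b⋆b` and functions make sense. -/
theorem toMultiplier_injective : Function.Injective (toMultiplier B) := fun a b hab =>
  eq_of_forall_mul_right fun z => by
    have h := congrArg (fun m : 𝓜(ℂ, B) => m.fst z) hab
    simpa [toMultiplier] using! h

theorem norm_toMultiplier (b : B) : ‖toMultiplier B b‖ = ‖b‖ :=
  NonUnitalStarAlgHom.norm_map _ toMultiplier_injective b

theorem θ_mul_toMultiplier (f : C₀(Y, ℂ)) (b : B) :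
    θ f * toMultiplier B b = toMultiplier B (act f b) := by
  refine DoubleCentralizer.ext _ _ _ _ (Prod.ext (ContinuousLinearMap.ext fun x => ?_)
    (ContinuousLinearMap.ext fun x => ?_))
  · simpa [toMultiplier] using! act_mul_apply f b x
  · change (θ f : 𝓜(ℂ, B)).snd x * b = x * act f b
    exact (θ f : 𝓜(ℂ, B)).central x b

/-- If `b⋆b` is bounded by `C` on the supports of the `k i`, then so is `∑ (k i)² b⋆b`. -/
theorem norm_act_sum_sq_le {ι : Type*} [Fintype ι] {k h : ι → C₀(Y, ℂ)} {b : B} {C : ℝ}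
    (hk : ∀ i, star (k i) = k i) (hh : ∀ i, star (h i) = h i) (hkh : ∀ i, k i * h i = k i)
    (hC0 : 0 ≤ C) (hC : ∀ i, ‖act (h i) (star b * b)‖ ≤ C) (h1 : ‖∑ i, k i * k i‖ ≤ 1) :
    ‖act (∑ i, k i * k i) (star b * b)‖ ≤ C := by
  set j := toMultiplier B
  have hks : ∀ i, star (θ (k i) : 𝓜(ℂ, B)) = θ (k i) := fun i => by rw [← map_star, hk]
  -- By centrality and self-adjointness, multiplication by `kᵢ²` is conjugation by `θ(kᵢ)`, which
  -- preserves positivity and order.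
  have hconj : ∀ i c, j (act (k i * k i) c) = star (θ (k i)) * j c * θ (k i) := fun i c => by
    rw [hks, mul_assoc, ← central, ← mul_assoc, ← map_mul, θ_mul_toMultiplier]
  have hkh' : ∀ i, act (k i * k i) (star b * b) = act (k i * k i) (act (h i) (star b * b)) :=
    fun i => by rw [← act_mul, mul_assoc, hkh]
  have hpos : 0 ≤ j (act (∑ i, k i * k i) (star b * b)) := by
    rw [act_sum, map_sum]
    refine Finset.sum_nonneg fun i _ => ?_
    rw [hconj, map_mul, map_star]
    exact star_left_conjugate_nonneg (star_mul_self_nonneg _) _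
  -- Termwise, `kᵢ² b⋆b = kᵢ (hᵢ b⋆b) kᵢ ≤ C kᵢ²`, because `hᵢ b⋆b` is self-adjoint of norm at most
  -- `C`. Adding operator inequalities, rather than norms, keeps the bound independent of the number
  -- of terms.
  have hle : j (act (∑ i, k i * k i) (star b * b)) ≤ (C : ℂ) • θ (∑ i, k i * k i) := by
    rw [act_sum, map_sum, map_sum, Finset.smul_sum]
    refine Finset.sum_le_sum fun i _ => ?_
    have hsa : IsSelfAdjoint (j (act (h i) (star b * b))) := by
      rw [IsSelfAdjoint, ← map_star, star_act, hh, star_mul, star_star]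
    have h2 : j (act (h i) (star b * b)) ≤ algebraMap ℝ _ C :=
      hsa.le_algebraMap_norm_self.trans (algebraMap_mono _ (by
        rw [norm_toMultiplier]; exact hC i))
    rw [hkh', hconj]
    refine (star_left_conjugate_le_conjugate h2 _).trans_eq ?_
    rw [hks, ← Algebra.commutes, mul_assoc, ← map_mul, ← Algebra.smul_def]
    exact (Complex.coe_smul C _).symm
  rw [← norm_toMultiplier]
  refine (CStarAlgebra.norm_le_norm_of_nonneg_of_le hpos hle).trans ?_
  rw [norm_smul, Complex.norm_real, Real.norm_of_nonneg hC0]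
  exact mul_le_of_le_one_right hC0 ((NonUnitalStarAlgHom.norm_apply_le _ _).trans h1)

variable [T2Space Y] [LocallyCompactSpace Y]

/-- The norm of an element of a `C₀(Y)`-algebra is determined by the norms of its germs. -/
theorem norm_le_of_forall_norm_germ_le {b : B} {C : ℝ} (hC : 0 ≤ C)
    (h : ∀ y : Y, ‖germ y b‖ ≤ C) : ‖b‖ ≤ C := by
  -- The order argument needs a positive element, hence the passage to `b⋆b` by the C⋆-identity.
  suffices hsq : ‖star b * b‖ ≤ C ^ 2 by
    rw [CStarRing.norm_star_mul_self, ← sq] at hsq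
    exact le_of_sq_le_sq hsq hC
  refine le_of_forall_pos_le_add fun ε hε => ?_
  obtain ⟨K, hK, hKg⟩ := exists_compact_norm_sub_act_le (X := Y) (star b * b) (half_pos hε)
  choose U hU hUg using fun y : Y => exists_nhds_norm_act_le y (star b * b) (half_pos hε)
  obtain ⟨t, g, hgc, hgU, hg0, hg1, hgK⟩ := exists_finite_partition hK hU
  -- A cut-off that is `1` where `gᵢ` does not vanish and is `0` off `Uᵢ`: it can be inserted next
  -- to `gᵢ` without effect, and it compresses `b⋆b` to norm about `‖b_{yᵢ}‖²`, where `yᵢ` is the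
  -- point with `Uᵢ` as its neighbourhood.
  have hexh : ∀ i : t, ∃ h : C₀(Y, ℂ), star h = h ∧ (∀ z ∉ U i, h z = 0) ∧ (∀ z, ‖h z‖ ≤ 1) ∧
      ∀ z, g i z ≠ 0 → h z = 1 := fun i => by
    obtain ⟨u, hu1, hu0, huc, hu⟩ := exists_continuous_one_zero_of_isCompact
      (s := tsupport (g i)) (hgc i) (isOpen_interior (s := U i)).isClosed_compl
      (Set.disjoint_compl_right_iff_subset.mpr (hgU i))
    refine ⟨compactC0 u huc, star_compactC0 u huc, fun z hz => ?_, fun z => ?_, fun z hz => ?_⟩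
    · have : u z = 0 := hu0 fun hz' => hz (interior_subset hz')
      simp [this]
    · rw [compactC0_apply, Complex.norm_real, Real.norm_of_nonneg (hu z).1]
      exact (hu z).2
    · have : u z = 1 := hu1 (subset_tsupport _ hz)
      simp [this]
  choose h' hhs hhU hh1 hhg using hexh
  -- Square roots turn the partition of unity into a sum of squares, as needed for conjugation.
  let k : t → C₀(Y, ℂ) := fun i =>
    compactC0 ⟨fun z => √(g i z), by fun_prop⟩ ((hgc i).comp_left Real.sqrt_zero)
  have hkz : ∀ i z, (k i * k i) z = (g i z : ℂ) := fun i z => by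
    change ((√(g i z) : ℝ) : ℂ) * ((√(g i z) : ℝ) : ℂ) = _
    rw [← Complex.ofReal_mul, Real.mul_self_sqrt (hg0 i z)]
  set G : C₀(Y, ℂ) := ∑ i, k i * k i
  have hGz : ∀ z, G z = ((∑ i, g i z : ℝ) : ℂ) := fun z => by
    rw [Complex.ofReal_sum, ← Finset.sum_congr rfl fun i _ => hkz i z]
    exact map_sum (Pullback.pointEval z) _ _
  have hGn : ∀ z, ‖G z‖ ≤ 1 := fun z => by
    rw [hGz, Complex.norm_real, Real.norm_of_nonneg (Finset.sum_nonneg fun i _ => hg0 i z)]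
    exact hg1 z
  have hsum : ‖act G (star b * b)‖ ≤ C ^ 2 + ε / 2 := by
    refine norm_act_sum_sq_le (h := h') (fun i => star_compactC0 _ _) hhs (fun i => ?_)
      (by positivity) (fun i => ?_) (norm_c0_le zero_le_one hGn)
    · ext z
      change k i z * h' i z = k i z
      by_cases hz : g i z = 0
      · have : k i z = 0 := by simp [k, hz]
        rw [this, zero_mul]
      · rw [hhg i z hz, mul_one]
    · refine (hUg i (h' i) (hhU i) (hh1 i)).trans ?_
      gcongr
      rw [map_mul, map_star, CStarRing.norm_star_mul_self, ← sq]
      gcongr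
      exact h i
  calc ‖star b * b‖ = ‖(star b * b - act G (star b * b)) + act G (star b * b)‖ := by
        rw [sub_add_cancel]
    _ ≤ ε / 2 + (C ^ 2 + ε / 2) := (norm_add_le _ _).trans (add_le_add
        (hKg G (fun z hz => by rw [hGz, hgK z hz, Complex.ofReal_one]) hGn) hsum)
    _ = _ := by ring

/-- An element of a `C₀(Y)`-algebra is determined by its germs. -/
theorem ext_germ {b c : B} (h : ∀ y : Y, germ y b = germ y c) : b = c := by
  rw [← sub_eq_zero, ← norm_le_zero_iff]
  exact norm_le_of_forall_norm_germ_le (Y := Y) le_rfl fun y => by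
    rw [map_sub, h, sub_self, norm_zero]

/-- Approximation of a section that is locally close to the sections given by elements. -/
theorem exists_forall_norm_sub_germ_le {s : ∀ y : Y, Fibre B y}
    (hloc : ∀ y, ∃ b : B, Filter.Tendsto (fun z => ‖s z - germ z b‖) (𝓝 y) (𝓝 0))
    (hinf : Filter.Tendsto (fun z => ‖s z‖) (Filter.cocompact Y) (𝓝 0)) {ε : ℝ} (hε : 0 < ε) :
    ∃ b : B, ∀ z, ‖s z - germ z b‖ ≤ ε := by
  choose b hb using hloc
  -- Off `K` the section itself is smaller than `ε`, so a partition of unity over `K` is enough.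
  obtain ⟨K, hK, hKs⟩ := Filter.mem_cocompact.mp (hinf.eventually_lt_const hε)
  obtain ⟨t, g, hgc, hgU, hg0, hg1, hgK⟩ := exists_finite_partition hK
    (U := fun y => {z | ‖s z - germ z (b y)‖ < ε}) fun y => (hb y).eventually_lt_const hε
  refine ⟨∑ i, act (compactC0 (g i) (hgc i)) (b i), fun z => ?_⟩
  -- The error is a convex combination of the local errors `s - bᵢ`, with weights `gᵢ`, and of `s`,
  -- with the remaining weight `1 - ∑ gᵢ`. That weight is zero on `K`, and `‖s‖ < ε` elsewhere.
  have h1 : s z - germ z (∑ i, act (compactC0 (g i) (hgc i)) (b i)) =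
      ((1 - ∑ i, g i z : ℝ) : ℂ) • s z + ∑ i, ((g i z : ℝ) : ℂ) • (s z - germ z (b i)) := by
    rw [map_sum]
    simp only [germ_act, compactC0_apply, smul_sub, Finset.sum_sub_distrib, ← Finset.sum_smul]
    rw [Complex.ofReal_sub, Complex.ofReal_sum, Complex.ofReal_one, sub_smul, one_smul]
    abel
  have h2 : ‖((1 - ∑ i, g i z : ℝ) : ℂ) • s z‖ ≤ (1 - ∑ i, g i z) * ε := by
    rw [norm_smul, Complex.norm_real, Real.norm_of_nonneg (sub_nonneg.mpr (hg1 z))]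
    by_cases hz : z ∈ K
    · rw [hgK z hz, sub_self, zero_mul, zero_mul]
    · have : ‖s z‖ < ε := hKs hz
      exact mul_le_mul_of_nonneg_left this.le (sub_nonneg.mpr (hg1 z))
  have h3 : ∀ i, ‖((g i z : ℝ) : ℂ) • (s z - germ z (b i))‖ ≤ g i z * ε := fun i => by
    rw [norm_smul, Complex.norm_real, Real.norm_of_nonneg (hg0 i z)]
    by_cases hz : g i z = 0
    · rw [hz, zero_mul, zero_mul]
    · have h4 : z ∈ {z | ‖s z - germ z (b i)‖ < ε} :=
        interior_subset (hgU i (subset_tsupport _ hz))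
      exact mul_le_mul_of_nonneg_left (le_of_lt h4) (hg0 i z)
  rw [h1]
  calc _ ≤ (1 - ∑ i, g i z) * ε + ∑ i, g i z * ε := (norm_add_le _ _).trans
        (add_le_add h2 ((norm_sum_le _ _).trans (Finset.sum_le_sum fun i _ => h3 i)))
    _ = ε := by rw [← Finset.sum_mul]; ring

/-- The sections given by the elements of a `C₀(Y)`-algebra are those that vanish at infinity and
are locally close to such sections. -/
theorem exists_germ_eq {s : ∀ y : Y, Fibre B y}
    (hloc : ∀ y, ∃ b : B, Filter.Tendsto (fun z => ‖s z - germ z b‖) (𝓝 y) (𝓝 0))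
    (hinf : Filter.Tendsto (fun z => ‖s z‖) (Filter.cocompact Y) (𝓝 0)) :
    ∃ b : B, ∀ z, germ z b = s z := by
  have hpos : ∀ n : ℕ, (0 : ℝ) < (1 / 2) ^ n := fun n => by positivity
  choose b hb using fun n : ℕ => exists_forall_norm_sub_germ_le hloc hinf (hpos n)
  have hlim : Filter.Tendsto (fun n : ℕ => 2 * (1 / 2 : ℝ) ^ n) Filter.atTop (𝓝 0) := by
    simpa using (tendsto_pow_atTop_nhds_zero_of_lt_one (r := (1 / 2 : ℝ)) (by norm_num)
      (by norm_num)).const_mul 2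
  -- The approximations are uniform over the fibres; the norm estimate by germs converts this into
  -- the Cauchy property in `B`.
  have hcau : CauchySeq b := by
    refine cauchySeq_of_le_tendsto_0' _ (fun n m hnm => ?_) hlim
    rw [dist_eq_norm]
    refine norm_le_of_forall_norm_germ_le (Y := Y) (by positivity) fun y => ?_
    have hm : ((1 : ℝ) / 2) ^ m ≤ (1 / 2) ^ n :=
      pow_le_pow_of_le_one (by norm_num) (by norm_num) hnm
    calc ‖germ y (b n - b m)‖ = ‖(s y - germ y (b m)) - (s y - germ y (b n))‖ := by
          rw [map_sub]; congr 1; abel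
      _ ≤ (1 / 2) ^ n + (1 / 2) ^ n := (norm_sub_le _ _).trans
          (add_le_add ((hb m y).trans hm) (hb n y))
      _ = _ := by ring
  obtain ⟨c, hc⟩ := cauchySeq_tendsto_of_complete hcau
  refine ⟨c, fun z => tendsto_nhds_unique
    (((continuous_starHom (germ z)).tendsto c).comp hc) ?_⟩
  rw [tendsto_iff_norm_sub_tendsto_zero]
  refine squeeze_zero (fun _ => norm_nonneg _) (fun n => ?_)
    (tendsto_pow_atTop_nhds_zero_of_lt_one (r := (1 / 2 : ℝ)) (by norm_num) (by norm_num))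
  rw [norm_sub_rev]
  exact hb n z

end Norm

end C0Algebra

/-! ### Sections of families of C⋆-algebras -/

/-- Injective `*`-homomorphisms of C⋆-algebras are isometric. This makes every family of fibre
isomorphisms uniformly bounded. -/
theorem norm_starAlgEquiv {D E : Type*} [NonUnitalCStarAlgebra D] [NonUnitalCStarAlgebra E]
    (e : D ≃⋆ₐ[ℂ] E) (d : D) : ‖e d‖ = ‖d‖ :=
  NonUnitalStarAlgHom.norm_map e e.injective d

/-- Sections `F(z) w(z)` and `w(z)` agree asymptotically where `F = 1`, if `w` is bounded. -/
theorem tendsto_norm_smul_sub {Y : Type*} [TopologicalSpace Y] {E : Y → Type*} [∀ z, NonUnitalCStarAlgebra (E z)]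
    {F : C₀(Y, ℂ)} {y : Y} (hF : F y = 1) (w : ∀ z, E z) {C : ℝ} (hw : ∀ z, ‖w z‖ ≤ C) :
    Filter.Tendsto (fun z => ‖F z • w z - w z‖) (𝓝 y) (𝓝 0) := by
  have h : Filter.Tendsto (fun z => ‖F z - 1‖ * C) (𝓝 y) (𝓝 0) := by
    have : Continuous fun z => ‖F z - 1‖ * C := by fun_prop
    simpa [hF] using this.tendsto y
  refine squeeze_zero (fun _ => norm_nonneg _) (fun z => ?_) h
  have : F z • w z - w z = (F z - 1) • w z := by rw [sub_smul, one_smul]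
  rw [this, norm_smul]
  gcongr
  exact hw z

/-- Sections take values in varying fibres, so closeness along a filter is expressed by norms of
differences. Together with `tendsto_norm_sub_symm` this makes it an equivalence relation. -/
theorem tendsto_norm_sub_trans {ι : Type*} {l : Filter ι} {E : ι → Type*}
    [∀ z, NonUnitalCStarAlgebra (E z)] {u v w : ∀ z, E z}
    (huv : Filter.Tendsto (fun z => ‖u z - v z‖) l (𝓝 0))
    (hvw : Filter.Tendsto (fun z => ‖v z - w z‖) l (𝓝 0)) :
    Filter.Tendsto (fun z => ‖u z - w z‖) l (𝓝 0) :=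
  squeeze_zero (fun _ => norm_nonneg _) (fun _ => norm_sub_le_norm_sub_add_norm_sub _ _ _)
    (by simpa using huv.add hvw)

theorem tendsto_norm_sub_symm {ι : Type*} {l : Filter ι} {E : ι → Type*}
    [∀ z, NonUnitalCStarAlgebra (E z)] {u v : ∀ z, E z}
    (huv : Filter.Tendsto (fun z => ‖u z - v z‖) l (𝓝 0)) :
    Filter.Tendsto (fun z => ‖v z - u z‖) l (𝓝 0) := by
  simpa only [norm_sub_rev] using huv

/-! ### Sections of the pullback -/

namespace Pullback

variable {X Y A : Type*} [TopologicalSpace X] [TopologicalSpace Y]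
  [NonUnitalCStarAlgebra A] [C0Algebra X A] [LocallyCompactSpace Y] [T2Space Y]

theorem fibreIso_germ (q : C(Y, X)) (y : Y) (t : Pullback A q) :
    fibreIso q y (C0Algebra.germ y t) = eval q y t := fibreHom_germ q y t

/-- The identification of `(q^*A)_y` with `A_{q(y)}` is isometric, so the results on germs carry
over to values. -/
theorem norm_eval (q : C(Y, X)) (y : Y) (t : Pullback A q) :
    ‖eval q y t‖ = ‖C0Algebra.germ y t‖ := by
  rw [← fibreIso_germ, norm_starAlgEquiv]

/-- An element of `q^*A` is determined by its values. -/
theorem ext_eval (q : C(Y, X)) {t u : Pullback A q} (h : ∀ y, eval q y t = eval q y u) : t = u :=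
  C0Algebra.ext_germ (Y := Y) fun y => EquivLike.injective (fibreIso q y) <| by
    rw [fibreIso_germ, fibreIso_germ, h]

theorem eval_surjective (q : C(Y, X)) (y : Y) :
    Function.Surjective (eval q y : Pullback A q → C0Algebra.Fibre A (q y)) := fun z => by
  obtain ⟨a, rfl⟩ := C0Algebra.germ_surjective _ (q y) z
  obtain ⟨F, hF, -⟩ := exists_apply_eq_one y
  exact ⟨tmul q a F, by rw [eval_tmul, hF, one_smul]⟩

theorem tendsto_norm_eval_cocompact (q : C(Y, X)) (t : Pullback A q) :
    Filter.Tendsto (fun z => ‖eval q z t‖) (Filter.cocompact Y) (𝓝 0) := by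
  simpa only [norm_eval] using C0Algebra.tendsto_norm_germ_cocompact (X := Y) t

/-- Near `y` an element of `q^*A` is close to any `a ∈ A` with the same value at `y`. -/
theorem tendsto_norm_eval_sub_germ (q : C(Y, X)) {y : Y} {t : Pullback A q} {a : A}
    (h : eval q y t = C0Algebra.germ (q y) a) :
    Filter.Tendsto (fun z => ‖eval q z t - C0Algebra.germ (q z) a‖) (𝓝 y) (𝓝 0) := by
  obtain ⟨F, hF, -⟩ := exists_apply_eq_one y
  -- An element `a ∈ A` is not an element of `q^*A`; it is replaced by `a ⊗ F` with `F(y) = 1`. The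
  -- difference then has zero germ at `y`, hence small germs nearby, and `F a` is close to `a` near
  -- `y`.
  have h0 : C0Algebra.germ y (t - tmul q a F) = 0 := by
    refine EquivLike.injective (fibreIso q y) ?_
    rw [fibreIso_germ, map_zero, map_sub, eval_tmul, hF, one_smul, h, sub_self]
  have h1 := C0Algebra.tendsto_norm_germ_zero h0
  have h2 : ∀ z, ‖C0Algebra.germ z (t - tmul q a F)‖ =
      ‖eval q z t - F z • C0Algebra.germ (q z) a‖ := fun z => by
    rw [← norm_eval, map_sub, eval_tmul]
  simp only [h2] at h1
  exact tendsto_norm_sub_trans h1 (tendsto_norm_smul_sub hF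
    (fun z => C0Algebra.germ (q z) a) fun z => C0Algebra.norm_germ_le (q z) a)

/-- A section vanishing at infinity and locally close to sections `y ↦ a_{q(y)}` is given by an
element of `q^*A`. -/
theorem exists_eval_eq (q : C(Y, X)) {s : ∀ y, C0Algebra.Fibre A (q y)}
    (hloc : ∀ y, ∃ a : A, Filter.Tendsto (fun z => ‖s z - C0Algebra.germ (q z) a‖) (𝓝 y) (𝓝 0))
    (hinf : Filter.Tendsto (fun z => ‖s z‖) (Filter.cocompact Y) (𝓝 0)) :
    ∃ t : Pullback A q, ∀ y, eval q y t = s y := by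
  suffices h : ∃ t : Pullback A q, ∀ y, C0Algebra.germ y t = (fibreIso q y).symm (s y) by
    obtain ⟨t, ht⟩ := h
    refine ⟨t, fun y => ?_⟩
    rw [← fibreIso_germ, ht, StarAlgEquiv.apply_symm_apply]
  refine C0Algebra.exists_germ_eq (fun y => ?_) ?_
  · obtain ⟨a, ha⟩ := hloc y
    obtain ⟨F, hF, -⟩ := exists_apply_eq_one y
    refine ⟨tmul q a F, ?_⟩
    -- The distance to `a ⊗ F` is measured in `A_{q(z)}`, where the local hypothesis is stated.
    have h1 : ∀ z, ‖(fibreIso q z).symm (s z) - C0Algebra.germ z (tmul q a F)‖ =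
        ‖s z - F z • C0Algebra.germ (q z) a‖ := fun z => by
      rw [← norm_starAlgEquiv (fibreIso q z), map_sub, StarAlgEquiv.apply_symm_apply,
        fibreIso_germ, eval_tmul]
    simp only [h1]
    exact tendsto_norm_sub_trans ha (tendsto_norm_sub_symm (tendsto_norm_smul_sub hF
      (fun z => C0Algebra.germ (q z) a) fun z => C0Algebra.norm_germ_le (q z) a))
  · simpa only [norm_starAlgEquiv] using hinf

end Pullback

/-! ### Continuous families of isomorphisms of the fibres -/

section Family

variable {X Y A : Type*} [TopologicalSpace X] [TopologicalSpace Y]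
  [NonUnitalCStarAlgebra A] [C0Algebra X A]

/-- Continuity of a family of isomorphisms `A_{q₁(y)} → A_{q₂(y)}`, expressed by elements of `A`:
if the image of `a` agrees with `b` at `y`, then it is close to `b` near `y`. -/
def ContinuousFamily {q₁ q₂ : C(Y, X)}
    (β : ∀ y, C0Algebra.Fibre A (q₁ y) ≃⋆ₐ[ℂ] C0Algebra.Fibre A (q₂ y)) : Prop :=
  ∀ (y : Y) (a b : A), β y (C0Algebra.germ (q₁ y) a) = C0Algebra.germ (q₂ y) b →
    Filter.Tendsto (fun z => ‖β z (C0Algebra.germ (q₁ z) a) - C0Algebra.germ (q₂ z) b‖)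
      (𝓝 y) (𝓝 0)

namespace ContinuousFamily

variable {q₁ q₂ : C(Y, X)} {β : ∀ y, C0Algebra.Fibre A (q₁ y) ≃⋆ₐ[ℂ] C0Algebra.Fibre A (q₂ y)}

/-- Each `β z` is isometric, so `‖β z⁻¹ a - b‖ = ‖β z b - a‖`: the condition for the inverse family
is the original one with `a` and `b` interchanged. -/
theorem symm (hβ : ContinuousFamily β) :
    ContinuousFamily (q₁ := q₂) (q₂ := q₁) fun y => (β y).symm := fun y a b hab => by
  have h : β y (C0Algebra.germ (q₁ y) b) = C0Algebra.germ (q₂ y) a := by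
    rw [← hab, StarAlgEquiv.apply_symm_apply]
  have h1 : ∀ z, ‖(β z).symm (C0Algebra.germ (q₂ z) a) - C0Algebra.germ (q₁ z) b‖ =
      ‖β z (C0Algebra.germ (q₁ z) b) - C0Algebra.germ (q₂ z) a‖ := fun z => by
    rw [← norm_starAlgEquiv (β z), map_sub, StarAlgEquiv.apply_symm_apply, norm_sub_rev]
  simpa only [h1] using hβ y b a h

variable [LocallyCompactSpace Y] [T2Space Y]

open Pullback in
-- The image section `y ↦ β y (t y)` meets the criterion for coming from `q₂^*A`: near `y` the
-- element `t` is close to some `a`, isometry moves this to `β a`, and continuity of the family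
-- makes `β a` close to some `b`. Decay at infinity is preserved because the `β y` are isometric.
theorem exists_eval_eq (hβ : ContinuousFamily β) (t : Pullback A q₁) :
    ∃ u : Pullback A q₂, ∀ y, eval q₂ y u = β y (eval q₁ y t) := by
  refine Pullback.exists_eval_eq q₂ (fun y => ?_) ?_
  · obtain ⟨a, ha⟩ := C0Algebra.germ_surjective A (q₁ y) (eval q₁ y t)
    obtain ⟨b, hb⟩ := C0Algebra.germ_surjective A (q₂ y) (β y (eval q₁ y t))
    refine ⟨b, tendsto_norm_sub_trans (v := fun z => β z (C0Algebra.germ (q₁ z) a)) ?_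
      (hβ y a b (by rw [ha, hb]))⟩
    simpa only [← map_sub, norm_starAlgEquiv] using tendsto_norm_eval_sub_germ q₁ ha.symm
  · simpa only [norm_starAlgEquiv] using tendsto_norm_eval_cocompact q₁ t

/-- The isomorphism of the pullbacks given by a continuous family. -/
theorem exists_c0Iso (hβ : ContinuousFamily β) :
    ∃ e : C0Iso Y (Pullback A q₁) (Pullback A q₂), ∀ y t,
      Pullback.eval q₂ y (e.toStarAlgEquiv t) = β y (Pullback.eval q₁ y t) := by
  choose φ hφ using hβ.exists_eval_eq
  choose ψ hψ using hβ.symm.exists_eval_eq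
  -- Elements of the pullbacks are determined by their values, so every algebraic identity is
  -- checked fibrewise, where `β y` is a `*`-isomorphism.
  let e : Pullback A q₁ ≃⋆ₐ[ℂ] Pullback A q₂ :=
    { toFun := φ
      invFun := ψ
      left_inv := fun t => Pullback.ext_eval q₁ fun y => by
        rw [hψ, hφ, StarAlgEquiv.symm_apply_apply]
      right_inv := fun t => Pullback.ext_eval q₂ fun y => by
        rw [hφ, hψ, StarAlgEquiv.apply_symm_apply]
      map_mul' := fun t u => Pullback.ext_eval q₂ fun y => by
        rw [hφ, map_mul, map_mul, map_mul, hφ, hφ]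
      map_add' := fun t u => Pullback.ext_eval q₂ fun y => by
        rw [hφ, map_add, map_add, map_add, hφ, hφ]
      map_star' := fun t => Pullback.ext_eval q₂ fun y => by
        rw [hφ, map_star, map_star, map_star, hφ]
      map_smul' := fun c t => Pullback.ext_eval q₂ fun y => by
        rw [hφ, map_smul, map_smul, map_smul, hφ] }
  refine ⟨⟨e, fun F t => Pullback.ext_eval q₂ fun y => ?_⟩, fun y t => hφ t y⟩
  change Pullback.eval q₂ y (φ (C0Algebra.act F t)) = Pullback.eval q₂ y (C0Algebra.act F (φ t))
  rw [hφ, Pullback.eval_act, Pullback.eval_act, map_smul, hφ]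

open Pullback in
/-- The family induced by an isomorphism of the pullbacks is continuous. -/
theorem of_c0Iso {e : C0Iso Y (Pullback A q₁) (Pullback A q₂)}
    (h : ∀ y t, eval q₂ y (e.toStarAlgEquiv t) = β y (eval q₁ y t)) : ContinuousFamily β :=
  fun y a b hab => by
    -- With `F(y) = 1`, the element `a ⊗ F` represents `a` near `y`, and `e` can be applied to it;
    -- its image has value `b_{q₂(y)}` at `y` and so is close to `b` nearby.
    obtain ⟨F, hF, -⟩ := exists_apply_eq_one y
    have hz : ∀ z, eval q₂ z (e.toStarAlgEquiv (tmul q₁ a F)) =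
        F z • β z (C0Algebra.germ (q₁ z) a) := fun z => by rw [h, eval_tmul, map_smul]
    have h1 := tendsto_norm_eval_sub_germ q₂ (t := e.toStarAlgEquiv (tmul q₁ a F)) (a := b)
      (y := y) (by rw [hz, hF, one_smul, hab])
    simp only [hz] at h1
    refine tendsto_norm_sub_trans (tendsto_norm_sub_symm (tendsto_norm_smul_sub hF
      (fun z => β z (C0Algebra.germ (q₁ z) a)) (C := ‖a‖) fun z => ?_)) h1
    rw [norm_starAlgEquiv]
    exact C0Algebra.norm_germ_le _ _

end ContinuousFamily

end Family

/-! ### The topology of the bundle `A^♯` -/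

namespace Sharp

variable {X A : Type*} [TopologicalSpace X] [NonUnitalCStarAlgebra A] [C0Algebra X A]

/-- The norms of the germs are upper semicontinuous. -/
theorem eventually_norm_germ_lt {x : X} {a : A} {r : ℝ} (h : ‖C0Algebra.germ x a‖ < r) :
    ∀ᶠ z in 𝓝 x, ‖C0Algebra.germ z a‖ < r := by
  set ε := (r - ‖C0Algebra.germ x a‖) / 2 with hε
  have hε0 : 0 < ε := by rw [hε]; linarith
  -- A lift `c` of `a_x` of nearly minimal norm bounds all its germs at once, and the germs of `a -
  -- c` are small near `x`.
  obtain ⟨c, hc, hcn⟩ := ClosedIdeal.Quot.exists_rep _ (C0Algebra.germ x a) hε0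
  have h0 : C0Algebra.germ x (a - c) = 0 := by rw [map_sub, sub_eq_zero]; exact hc.symm
  filter_upwards [(C0Algebra.tendsto_norm_germ_zero h0).eventually_lt_const hε0] with z hz
  calc ‖C0Algebra.germ z a‖ = ‖C0Algebra.germ z c + C0Algebra.germ z (a - c)‖ := by
        rw [← map_add, add_sub_cancel]
    _ ≤ ‖c‖ + ‖C0Algebra.germ z (a - c)‖ :=
        (norm_add_le _ _).trans (by gcongr; exact C0Algebra.norm_germ_le _ _)
    _ < (‖C0Algebra.germ x a‖ + ε) + ε := add_lt_add hcn hz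
    _ = r := by rw [hε]; ring

/-- Convergence in `A^♯` to the germ of `a` at `x`. -/
theorem tendsto_nhds_germ {ι : Type*} {l : Filter ι} {f : ι → Sharp X A} {x : X} {a : A} :
    Filter.Tendsto f l (𝓝 ⟨x, C0Algebra.germ x a⟩) ↔
      Filter.Tendsto (fun i => (f i).pt) l (𝓝 x) ∧
      Filter.Tendsto (fun i => ‖(f i).val - C0Algebra.germ (f i).pt a‖) l (𝓝 0) := by
  rw [TopologicalSpace.tendsto_nhds_generateFrom_iff]
  constructor
  · intro h
    constructor
    · refine tendsto_nhds.mpr fun U hU hx => ?_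
      -- The radius is immaterial here: only the condition on base points is used.
      have := h _ ⟨U, a, 1, hU, one_pos, rfl⟩ ⟨hx, by simp⟩
      filter_upwards [this] with i hi using hi.1
    · refine Metric.tendsto_nhds.mpr fun ε hε => ?_
      have := h _ ⟨Set.univ, a, ε, isOpen_univ, hε, rfl⟩ ⟨trivial, by simpa using hε⟩
      filter_upwards [this] with i hi
      rw [dist_zero_right, norm_norm]
      exact hi.2
  · rintro ⟨hpt, hval⟩ _ ⟨U, b, ε, hU, hε, rfl⟩ ⟨hx, hxε⟩
    change ‖C0Algebra.germ x a - C0Algebra.germ x b‖ < ε at hxε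
    rw [← map_sub] at hxε
    -- For a basic set given by another element `b`, upper semicontinuity keeps `‖a_z - b_z‖` below
    -- `δ` near `x`; the rest `ε - δ` is left for the distance to `a`.
    obtain ⟨δ, hδ, hδε⟩ := exists_between hxε
    filter_upwards [hpt.eventually (hU.mem_nhds hx), hpt.eventually (eventually_norm_germ_lt hδ),
      hval.eventually_lt_const (sub_pos.mpr hδε)] with i h1 h2 h3
    refine ⟨h1, ?_⟩
    rw [map_sub] at h2
    calc _ ≤ ‖(f i).val - C0Algebra.germ (f i).pt a‖ +
          ‖C0Algebra.germ (f i).pt a - C0Algebra.germ (f i).pt b‖ :=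
            norm_sub_le_norm_sub_add_norm_sub _ _ _
      _ < (ε - δ) + δ := add_lt_add h3 h2
      _ = ε := sub_add_cancel _ _

theorem exists_eq_germ (z : Sharp X A) : ∃ (x : X) (a : A), z = ⟨x, C0Algebra.germ x a⟩ := by
  obtain ⟨x, v⟩ := z
  obtain ⟨a, rfl⟩ := C0Algebra.germ_surjective A x v
  exact ⟨x, a, rfl⟩

theorem continuous_germ (a : A) :
    Continuous fun x : X => (⟨x, C0Algebra.germ x a⟩ : Sharp X A) :=
  continuous_iff_continuousAt.mpr fun x =>
    tendsto_nhds_germ.mpr ⟨Filter.tendsto_id, by simp⟩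

theorem continuous_pt : Continuous (BundleTotal.pt : Sharp X A → X) :=
  continuous_iff_continuousAt.mpr fun z => by
    obtain ⟨x, a, rfl⟩ := exists_eq_germ z
    exact (tendsto_nhds_germ.mp Filter.tendsto_id).1

/-- Through every point of `A^♯` passes a continuous section `x ↦ a_x`. -/
theorem isOpenMap_pt : IsOpenMap (BundleTotal.pt : Sharp X A → X) :=
  IsOpenMap.of_sections fun z => by
    obtain ⟨x, a, rfl⟩ := exists_eq_germ z
    exact ⟨_, (continuous_germ a).continuousAt, rfl, fun _ => rfl⟩

theorem surjective_pt : Function.Surjective (BundleTotal.pt : Sharp X A → X) :=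
  fun x => ⟨⟨x, 0⟩, rfl⟩

end Sharp

/-! ### Actions of a groupoid -/

section Gamma

open CategoryTheory

variable {X A : Type*} [Groupoid X] [TopologicalSpace X] [TopologicalSpace (Arrows X)]
  [IsTopologicalGroupoid X] [NonUnitalCStarAlgebra A] [C0Algebra X A]

/-- The action on `A^♯` given by a family of isomorphisms is continuous if and only if the family
is. -/
theorem continuous_act_iff
    (β : ∀ γ : Arrows X, C0Algebra.Fibre A γ.src ≃⋆ₐ[ℂ] C0Algebra.Fibre A γ.tgt) :
    (Continuous fun w : {w : Arrows X × Sharp X A // w.1.src = w.2.pt} =>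
      (⟨w.1.1.tgt, β w.1.1 (w.2.symm ▸ w.1.2.val)⟩ : Sharp X A)) ↔
    ContinuousFamily (q₁ := srcMap X) (q₂ := tgtMap X) β := by
  constructor
  · intro hc γ a b hab
    -- The action is tested along `γ ↦ (γ, a_{s(γ)})`, a continuous map into `Γ ×ₛ A^♯`.
    have h1 : Continuous fun γ : Arrows X =>
        (⟨(γ, ⟨γ.src, C0Algebra.germ γ.src a⟩), rfl⟩ :
          {w : Arrows X × Sharp X A // w.1.src = w.2.pt}) :=
      (continuous_id.prodMk ((Sharp.continuous_germ a).comp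
        IsTopologicalGroupoid.continuous_src)).subtype_mk _
    have h2 : Filter.Tendsto (fun γ : Arrows X =>
        (⟨γ.tgt, β γ (C0Algebra.germ γ.src a)⟩ : Sharp X A)) (𝓝 γ)
        (𝓝 ⟨γ.tgt, β γ (C0Algebra.germ γ.src a)⟩) := (hc.comp h1).tendsto γ
    have h3 : β γ (C0Algebra.germ γ.src a) = C0Algebra.germ γ.tgt b := hab
    rw [h3] at h2
    exact (Sharp.tendsto_nhds_germ.mp h2).2
  · intro hβ
    refine continuous_iff_continuousAt.mpr fun w => ?_
    obtain ⟨⟨γ, ⟨x, v⟩⟩, hx⟩ := w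
    change γ.src = x at hx
    subst hx
    obtain ⟨a, rfl⟩ := C0Algebra.germ_surjective A γ.src v
    obtain ⟨b, hb⟩ := C0Algebra.germ_surjective A γ.tgt (β γ (C0Algebra.germ γ.src a))
    have hfst : Filter.Tendsto (fun w : {w : Arrows X × Sharp X A // w.1.src = w.2.pt} => w.1.1)
        (𝓝 ⟨(γ, ⟨γ.src, C0Algebra.germ γ.src a⟩), rfl⟩) (𝓝 γ) :=
      (continuous_fst.comp continuous_subtype_val).tendsto _
    have hsnd : Filter.Tendsto (fun w : {w : Arrows X × Sharp X A // w.1.src = w.2.pt} => w.1.2)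
        (𝓝 ⟨(γ, ⟨γ.src, C0Algebra.germ γ.src a⟩), rfl⟩) (𝓝 ⟨γ.src, C0Algebra.germ γ.src a⟩) :=
      (continuous_snd.comp continuous_subtype_val).tendsto _
    -- The image point is written as the germ of some `b`, the form in which convergence in `A^♯` is
    -- described.
    have hlim : ContinuousAt (fun w : {w : Arrows X × Sharp X A // w.1.src = w.2.pt} =>
        (⟨w.1.1.tgt, β w.1.1 (w.2.symm ▸ w.1.2.val)⟩ : Sharp X A))
        ⟨(γ, ⟨γ.src, C0Algebra.germ γ.src a⟩), rfl⟩ ↔ Filter.Tendsto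
        (fun w : {w : Arrows X × Sharp X A // w.1.src = w.2.pt} =>
          (⟨w.1.1.tgt, β w.1.1 (w.2.symm ▸ w.1.2.val)⟩ : Sharp X A))
        (𝓝 ⟨(γ, ⟨γ.src, C0Algebra.germ γ.src a⟩), rfl⟩) (𝓝 ⟨γ.tgt, C0Algebra.germ γ.tgt b⟩) := by
      rw [hb]; rfl
    rw [hlim, Sharp.tendsto_nhds_germ]
    refine ⟨(IsTopologicalGroupoid.continuous_tgt.tendsto γ).comp hfst, ?_⟩
    refine tendsto_norm_sub_trans
      (v := fun w : {w : Arrows X × Sharp X A // w.1.src = w.2.pt} =>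
        β w.1.1 (C0Algebra.germ w.1.1.src a)) ?_ ((hβ γ a b hb.symm).comp hfst)
    -- Isometry removes the isomorphism, which varies with `w`. Once the base point is substituted,
    -- the transport between fibres disappears.
    have hn : ∀ w : {w : Arrows X × Sharp X A // w.1.src = w.2.pt},
        ‖β w.1.1 (w.2.symm ▸ w.1.2.val) - β w.1.1 (C0Algebra.germ w.1.1.src a)‖ =
          ‖w.1.2.val - C0Algebra.germ w.1.2.pt a‖ := by
      rintro ⟨⟨η, ⟨x, v⟩⟩, hx⟩
      change η.src = x at hx
      subst hx
      rw [← map_sub, norm_starAlgEquiv]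
    simp only [hn]
    exact (Sharp.tendsto_nhds_germ.mp hsnd).2

/-! ### The bijection between `C₀(Γ)`-isomorphisms and continuous families -/

variable [T2Space (Arrows X)] [LocallyCompactSpace (Arrows X)]

/-- This characterises `α_γ` by values of sections, with the identifications of the fibres
eliminated; it is what links `inducedIso` to `ContinuousFamily`. -/
theorem inducedIso_eval (α : C0Iso (Arrows X) (Pullback A (srcMap X)) (Pullback A (tgtMap X)))
    (γ : Arrows X) (t : Pullback A (srcMap X)) :
    inducedIso α γ (Pullback.eval (srcMap X) γ t) =
      Pullback.eval (tgtMap X) γ (α.toStarAlgEquiv t) := by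
  rw [← Pullback.fibreIso_germ (srcMap X)]
  change Pullback.fibreIso (tgtMap X) γ (α.fibreHom γ ((Pullback.fibreIso (srcMap X) γ).symm
    (Pullback.fibreIso (srcMap X) γ (C0Algebra.germ γ t)))) = _
  rw [StarAlgEquiv.symm_apply_apply, C0Iso.fibreHom_germ, Pullback.fibreIso_germ]

/-- A `C₀(Γ)`-isomorphism is determined by the induced isomorphisms of the fibres. -/
theorem inducedIso_injective : Function.Injective (inducedIso (X := X) (A := A)) := by
  intro α α' h
  have h1 : α.toStarAlgEquiv = α'.toStarAlgEquiv := by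
    refine StarAlgEquiv.ext fun t => Pullback.ext_eval (tgtMap X) fun γ => ?_
    rw [← inducedIso_eval, ← inducedIso_eval, h]
  cases α
  cases α'
  congr

theorem continuousFamily_inducedIso
    (α : C0Iso (Arrows X) (Pullback A (srcMap X)) (Pullback A (tgtMap X))) :
    ContinuousFamily (q₁ := srcMap X) (q₂ := tgtMap X) (inducedIso α) :=
  ContinuousFamily.of_c0Iso (e := α) fun γ t => (inducedIso_eval α γ t).symm

/-- The isomorphism built from the family induces it on all values of elements of `s^*A`, and these
values fill each fibre. -/
theorem exists_inducedIso_eq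
    {β : ∀ γ : Arrows X, C0Algebra.Fibre A γ.src ≃⋆ₐ[ℂ] C0Algebra.Fibre A γ.tgt}
    (hβ : ContinuousFamily (q₁ := srcMap X) (q₂ := tgtMap X) β) :
    ∃ α : C0Iso (Arrows X) (Pullback A (srcMap X)) (Pullback A (tgtMap X)), inducedIso α = β := by
  obtain ⟨e, he⟩ := hβ.exists_c0Iso
  refine ⟨e, funext fun γ => StarAlgEquiv.ext fun z => ?_⟩
  obtain ⟨t, rfl⟩ := Pullback.eval_surjective (srcMap X) γ z
  exact (inducedIso_eval e γ t).trans (he γ t)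

/-- The continuous action on `A^♯` given by a `Γ`-algebra structure. -/
def GammaAlgebra.toContinuousGammaSpace (α : GammaAlgebra X A) :
    ContinuousGammaSpace X fun x : X => C0Algebra.Fibre A x where
  continuous_proj := Sharp.continuous_pt
  isOpenMap_proj := Sharp.isOpenMap_pt
  surjective_proj := Sharp.surjective_pt
  iso := inducedIso α.iso
  map_unit x z := by
    -- The isomorphism of a unit is idempotent by multiplicativity; an injective idempotent map is
    -- the identity.
    refine EquivLike.injective (inducedIso α.iso ⟨x, x, 𝟙 x⟩) ?_
    have h := DFunLike.congr_fun (α.map_mul (𝟙 x) (𝟙 x)) z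
    rw [Category.comp_id] at h
    exact h.symm
  map_mul g f w := DFunLike.congr_fun (α.map_mul g f) w
  continuous_act := (continuous_act_iff _).mpr (continuousFamily_inducedIso α.iso)

theorem GammaAlgebra.toContinuousGammaSpace_injective :
    Function.Injective (GammaAlgebra.toContinuousGammaSpace (X := X) (A := A)) := by
  intro α α' h
  have h1 : α.iso = α'.iso := inducedIso_injective (congrArg ContinuousGammaSpace.iso h)
  cases α
  cases α'
  congr

/-- Multiplicativity is taken over from the given action. The law for inverses is not among its
axioms and follows from multiplicativity and the law for units. -/
theorem GammaAlgebra.toContinuousGammaSpace_surjective :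
    Function.Surjective (GammaAlgebra.toContinuousGammaSpace (X := X) (A := A)) := by
  intro S
  obtain ⟨e, he⟩ := exists_inducedIso_eq ((continuous_act_iff S.iso).mp S.continuous_act)
  refine ⟨⟨e, fun g f => ?_, fun {x y} f => ?_⟩, ?_⟩
  · rw [he]
    exact StarAlgEquiv.ext fun w => S.map_mul g f w
  · rw [he]
    refine StarAlgEquiv.ext fun w => EquivLike.injective (S.iso ⟨x, y, f⟩) ?_
    -- After applying `α_f`, the claim is `α_f α_{f⁻¹} = id`, the action of a unit.
    rw [StarAlgEquiv.apply_symm_apply, ← S.map_mul, Groupoid.inv_comp, S.map_unit]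
  · cases S
    simp only [toContinuousGammaSpace]
    congr

end Gamma

end

theorem mainTheorem4 (X : Type*) [CategoryTheory.Groupoid X] [TopologicalSpace X]
    [TopologicalSpace (Arrows X)] [IsTopologicalGroupoid X]
    [T2Space (Arrows X)] [LocallyCompactSpace (Arrows X)]
    (A : Type*) [NonUnitalCStarAlgebra A] [C0Algebra X A] :
    (Nonempty (GammaAlgebra X A) ↔
      Nonempty (ContinuousGammaSpace X fun x : X => C0Algebra.Fibre A x)) ∧
    ∃ e : GammaAlgebra X A ≃ ContinuousGammaSpace X fun x : X => C0Algebra.Fibre A x,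
      ∀ (α : GammaAlgebra X A) (γ : Arrows X), (e α).iso γ = inducedIso α.iso γ := by
  let e := Equiv.ofBijective (GammaAlgebra.toContinuousGammaSpace (X := X) (A := A))
    ⟨GammaAlgebra.toContinuousGammaSpace_injective, GammaAlgebra.toContinuousGammaSpace_surjective⟩
  exact ⟨e.nonempty_congr, e, fun _ _ => rfl⟩
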